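/- **Theorem (Reisner).** Let $\Sigma$ be a simplicial complex on a finite vertex set $V$, i.e. a set of subsets of $V$ (the faces) that contains $\varnothing$ and $\{v\}$ for every $v\in V$ and is closed under taking subsets, and let $k$ be a field. Put $\dim\sigma=|\sigma|-1$ for a face $\sigma$, and let the dimension of a complex be the maximum of the dimensions of its faces (so $\dim\{\varnothing\}=-1$). For $\sigma\in\Sigma$ let $\operatorname{lk}\sigma=\{\tau\in\Sigma\mid \sigma\cap\tau=\varnothing,\ \sigma\cup\tau\in\Sigma\}$ be the link of $\sigma$. Let $k[\Sigma]=k[X_v\mid v\in V]/I$ be the face ring, where $I$ is the ideal generated by the monomials $\prod_{v\in s}X_v$ with $s\subseteq V$, $s\notin\Sigma$. Let $\tilde H_i(-,k)$ denote reduced simplicial homology, i.e. the homology of the augmented chain complex with coefficients in $k$, formed with respect to a total order of $V$, with the empty face in degree $-1$. Call a Noetherian ring Cohen–Macaulay if its localization at every maximal ideal has depth equal to its Krull dimension. Then $k[\Sigma]$ is Cohen–Macaulay if and only if $$\tilde H_i(\operatorname{lk}\sigma,k)=0\quad\text{for all }\sigma\in\Sigma\text{ and all } i<\dim(\operatorname{lk}\sigma),$$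 and $$\tilde H_i(\Sigma,k)=0\quad\text{for all } i<\dim\Sigma.$$ -/

import Mathlib

namespace Reisner

universe u v

section Complexes

variable {V : Type u}

/-- All faces of a simplicial complex, the empty face included. Mathlib's convention lists only the
nonempty faces of a complex; here the empty set is always a face (of dimension `-1`). -/
def faceSet (K : PreAbstractSimplicialComplex V) : Set (Finset V) :=
  insert ∅ K.faces

theorem mem_faceSet_of_subset (K : PreAbstractSimplicialComplex V) {s t : Finset V}
    (hs : s ∈ faceSet K) (hts : t ⊆ s) : t ∈ faceSet K := by
  rcases t.eq_empty_or_nonempty with rfl | ht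
  · exact Set.mem_insert _ _
  · rcases hs with rfl | hs
    · exact absurd (Finset.subset_empty.mp hts) ht.ne_empty
    · exact Or.inr ((K.isRelLowerSet_faces hs).2 hts ht)

open Classical in
/-- The dimension of a simplicial complex on a finite vertex set: the maximum over all faces
(including the empty one) of the number of vertices minus one. It is `-1` if `∅` is the only
face. -/
noncomputable def dim [Fintype V] (K : PreAbstractSimplicialComplex V) : ℤ :=
  (((Finset.univ.filter (fun s : Finset V => s ∈ faceSet K)).sup Finset.card : ℕ) : ℤ) - 1

/-- The link of `σ`: the complex whose faces, the empty one included if `σ` is a face, are the `τ`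
disjoint from `σ` such that `σ ∪ τ` is a face. -/
def link [DecidableEq V] (K : PreAbstractSimplicialComplex V) (σ : Finset V) :
    PreAbstractSimplicialComplex V where
  faces := {τ | τ.Nonempty ∧ Disjoint σ τ ∧ σ ∪ τ ∈ faceSet K}
  isRelLowerSet_faces := fun {_} h =>
    ⟨h.1, fun _ hts ht => ⟨ht, h.2.1.mono_right hts,
      mem_faceSet_of_subset K h.2.2 (Finset.union_subset_union_right hts)⟩⟩

end Complexes

section FaceRing

variable {V : Type u}

/-- The ideal generated by the monomials `∏ i ∈ s, X i` with `s` not a face. -/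
noncomputable def nonfaceIdeal (k : Type v) [CommRing k] (K : PreAbstractSimplicialComplex V) :
    Ideal (MvPolynomial V k) :=
  Ideal.span {p | ∃ s : Finset V, s ∉ faceSet K ∧ p = ∏ i ∈ s, MvPolynomial.X i}

/-- The face ring (Stanley–Reisner ring) `k[K]`. -/
abbrev FaceRing (k : Type v) [CommRing k] (K : PreAbstractSimplicialComplex V) : Type (max u v) :=
  MvPolynomial V k ⧸ nonfaceIdeal k K

end FaceRing

section CohenMacaulay

/-- The depth of a local ring: the supremum of the lengths of the regular sequences contained in the
maximal ideal. -/
noncomputable def localDepth (A : Type u) [CommRing A] [IsLocalRing A] : ℕ∞ :=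
  ⨆ rs : {rs : List A // RingTheory.Sequence.IsRegular A rs ∧
    ∀ r ∈ rs, r ∈ IsLocalRing.maximalIdeal A}, (rs.1.length : ℕ∞)

/-- A commutative ring is Cohen–Macaulay if it is Noetherian and its localization at every maximal
ideal has depth equal to its Krull dimension. -/
structure IsCohenMacaulay (A : Type u) [CommRing A] : Prop where
  isNoetherianRing : IsNoetherianRing A
  depth_eq_dim : ∀ (M : Ideal A) [M.IsMaximal],
    (localDepth (Localization.AtPrime M) : WithBot ℕ∞) = ringKrullDim (Localization.AtPrime M)

end CohenMacaulay

section Homology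

variable {V : Type u} [LinearOrder V]

/-- The module of `i`-chains, `i : ℤ`: the free module on the faces with `i + 1` vertices. It is
free of rank one for `i = -1` and zero for `i < -1`. -/
abbrev Chains (k : Type v) [CommRing k] (K : PreAbstractSimplicialComplex V) (i : ℤ) :
    Type (max u v) :=
  {s : Finset V // s ∈ faceSet K ∧ (s.card : ℤ) = i + 1} →₀ k

open Classical in
/-- The basis element of `Chains k K i` given by `t`, or `0` if `t` is not an `i`-dimensional
face. -/
noncomputable def basisChain (k : Type v) [CommRing k] (K : PreAbstractSimplicialComplex V) (i : ℤ)
    (t : Finset V) : Chains k K i :=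
  if h : t ∈ faceSet K ∧ (t.card : ℤ) = i + 1 then Finsupp.single ⟨t, h⟩ 1 else 0

/-- The boundary of the `i`-face `s`, in degree `j`. For `v` the `m`-th vertex of `s` (counted from
`0` in increasing order), `s.erase v` occurs with sign `(-1) ^ m`. The sum is zero unless
`j + 1 = i`. -/
noncomputable def boundary (k : Type v) [CommRing k] (K : PreAbstractSimplicialComplex V)
    (i j : ℤ) : Chains k K i →ₗ[k] Chains k K j :=
  Finsupp.linearCombination k fun s =>
    ∑ v ∈ s.1, (-1 : k) ^ (s.1.filter (· < v)).card • basisChain k K j (s.1.erase v)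

theorem boundary_basisChain (k : Type v) [CommRing k] (K : PreAbstractSimplicialComplex V)
    (i j : ℤ) (t : Finset V) (ht : t ∈ faceSet K) (hc : (t.card : ℤ) = i + 1) :
    boundary k K i j (basisChain k K i t) =
      ∑ v ∈ t, (-1 : k) ^ (t.filter (· < v)).card • basisChain k K j (t.erase v) := by
  rw [basisChain, dif_pos ⟨ht, hc⟩, boundary, Finsupp.linearCombination_single, one_smul]

theorem boundary_shape (k : Type v) [CommRing k] (K : PreAbstractSimplicialComplex V)
    (i j : ℤ) (h : j + 1 ≠ i) : boundary k K i j = 0 := by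
  ext1 s
  ext1
  simp only [boundary, LinearMap.comp_apply, Finsupp.lsingle_apply,
    Finsupp.linearCombination_single, one_smul, LinearMap.zero_apply]
  refine Finset.sum_eq_zero fun v hv => ?_
  rw [basisChain, dif_neg, smul_zero]
  rintro ⟨-, h2⟩
  have h3 := Finset.card_erase_add_one hv
  have h4 := s.2.2
  omega

theorem boundary_comp (k : Type v) [CommRing k] (K : PreAbstractSimplicialComplex V)
    (i j l : ℤ) (hij : j + 1 = i) : boundary k K j l ∘ₗ boundary k K i j = 0 := by
  ext1 s
  ext1
  obtain ⟨s, hs, hc⟩ := s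
  simp only [LinearMap.comp_apply, Finsupp.lsingle_apply, LinearMap.zero_apply]
  have e : boundary k K i j (Finsupp.single ⟨s, hs, hc⟩ 1) =
      ∑ v ∈ s, (-1 : k) ^ (s.filter (· < v)).card • basisChain k K j (s.erase v) := by
    simp [boundary]
  rw [e, map_sum]
  have e2 : ∀ v ∈ s, boundary k K j l
      ((-1 : k) ^ (s.filter (· < v)).card • basisChain k K j (s.erase v)) =
      ∑ w ∈ s.erase v, ((-1 : k) ^ (s.filter (· < v)).card *
        (-1 : k) ^ ((s.erase v).filter (· < w)).card) •
        basisChain k K l ((s.erase v).erase w) := by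
    intro v hv
    have h3 := Finset.card_erase_add_one hv
    rw [map_smul, boundary_basisChain k K j l (s.erase v)
      (mem_faceSet_of_subset K hs (Finset.erase_subset _ _)) (by omega), Finset.smul_sum]
    simp only [smul_smul]
  rw [Finset.sum_congr rfl e2, Finset.sum_sigma']
  have key : ∀ v w, v ∈ s → w ∈ s → v < w →
      (-1 : k) ^ (s.filter (· < v)).card * (-1 : k) ^ ((s.erase v).filter (· < w)).card +
      (-1 : k) ^ (s.filter (· < w)).card * (-1 : k) ^ ((s.erase w).filter (· < v)).card = 0 := by
    intro v w hv hw hvw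
    have h1 : ((s.erase v).filter (· < w)).card + 1 = (s.filter (· < w)).card := by
      rw [Finset.filter_erase]
      exact Finset.card_erase_add_one (by simp [hv, hvw])
    have h2 : ((s.erase w).filter (· < v)) = s.filter (· < v) := by
      rw [Finset.filter_erase]
      exact Finset.erase_eq_of_notMem (by simp [hvw.le])
    rw [h2, ← h1, pow_succ]
    ring
  refine Finset.sum_involution (fun p _ => ⟨p.2, p.1⟩) ?_ ?_ ?_ ?_
  · rintro ⟨v, w⟩ hp
    simp only [Finset.mem_sigma, Finset.mem_erase] at hp
    rw [Finset.erase_right_comm, ← add_smul]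
    rcases lt_or_gt_of_ne hp.2.1 with h | h
    · rw [add_comm ((-1 : k) ^ _ * _), key w v hp.2.2 hp.1 h, zero_smul]
    · rw [key v w hp.1 hp.2.2 h, zero_smul]
  · rintro ⟨v, w⟩ hp - h
    simp only [Finset.mem_sigma, Finset.mem_erase] at hp
    simp only [Sigma.mk.injEq] at h
    exact hp.2.1 h.1
  · rintro ⟨v, w⟩ hp
    simp only [Finset.mem_sigma, Finset.mem_erase] at hp ⊢
    exact ⟨hp.2.2, hp.2.1.symm, hp.1⟩
  · rintro ⟨v, w⟩ hp
    rfl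

/-- The augmented oriented chain complex of `K` with coefficients in `k`, indexed by `ℤ`, with the
empty face in degree `-1`. -/
noncomputable def augmentedChainComplex (k : Type v) [CommRing k]
    (K : PreAbstractSimplicialComplex V) : ChainComplex (ModuleCat.{max u v} k) ℤ where
  X i := ModuleCat.of k (Chains k K i)
  d i j := ModuleCat.ofHom (boundary k K i j)
  shape i j h := by
    rw [boundary_shape k K i j h]
    rfl
  d_comp_d' i j l hij _ := by
    rw [← ModuleCat.ofHom_comp, boundary_comp k K i j l hij]
    rfl

/-- The reduced simplicial homology of `K` in degree `i` with coefficients in `k`. -/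
noncomputable def reducedHomology (k : Type v) [CommRing k] (K : PreAbstractSimplicialComplex V)
    (i : ℤ) : ModuleCat.{max u v} k :=
  (augmentedChainComplex k K).homology i

end Homology

end Reisner

/-! The bridge between topology and algebra is the Koszul complex of the variables on the face ring.
It is multigraded. In a multidegree with a positive entry at some vertex it is contractible, and in
each remaining multidegree it is, up to shift and signs, the augmented cochain complex of a deletion
`del Δ G`. Hence Koszul vanishing below degree `d` means that `del Δ G` has no reduced cohomology on
faces with `n` vertices whenever `n + |G| < d` (`koszulVanishes_of_acyclicAt`,
`acyclicAt_of_koszulVanishes`). The exact sequence relating a complex, the deletion of a vertex and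
its link shows that this is equivalent to the same condition on all links (`acyclicAt_lk_iff_del`).
If `d` is the maximal size of a face, that condition is Reisner's criterion, because the criterion
forces the complex to be pure (`LinksAcyclic.exists_superset_card_eq`). Over a field, homology and
cohomology vanish together.

If the ring is Cohen–Macaulay, its depth at the ideal of the variables is at least `d`. A regular
sequence of that length kills Koszul cohomology below `d`. Denominators are harmless, since a
polynomial acts on Koszul cohomology through its constant term.

Conversely, a regular sequence of length `d` is needed at every maximal ideal `M`. If `M` contains
all variables, prime avoidance builds one from Koszul vanishing. If `X v ∉ M`, inverting `X v` turns
the face ring into that of the link of `v` with a Laurent variable adjoined. A monic `f` with `f (X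
v) ∈ M` gives the first element, and modulo it one is left with the link over `L[T]/(f)` and the
bound `d - 1` (`exists_locRegular_faceIdeal`). This recursion is why the coefficients are general
Noetherian algebras over the field. Since the Krull dimension is at most `d`, depth and dimension
both equal `d`. -/

namespace Reisner

universe u v

/-! ### Koszul cochains and contractions -/

section Koszul

variable {V : Type*} [LinearOrder V] {R : Type*} [CommRing R] {N : Type*} [AddCommGroup N]
  [Module R N]

/-- The Koszul differential of the family `x` with coefficients in `N`, on cochains written as
functions of the finite subsets of the index set. -/
def koszulD (x : V → R) : (Finset V → N) →ₗ[R] (Finset V → N) where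
  toFun c F := ∑ v ∈ F, ((-1 : R) ^ (F.filter (· < v)).card * x v) • c (F.erase v)
  map_add' c c' := by
    ext F
    simp [smul_add, Finset.sum_add_distrib]
  map_smul' r c := by
    ext F
    simp only [Pi.smul_apply, RingHom.id_apply, Finset.smul_sum]
    exact Finset.sum_congr rfl fun v _ => smul_comm _ _ _

theorem koszulD_apply (x : V → R) (c : Finset V → N) (F : Finset V) :
    koszulD x c F = ∑ v ∈ F, ((-1 : R) ^ (F.filter (· < v)).card * x v) • c (F.erase v) := rfl

theorem koszulD_congr (x : V → R) {c c' : Finset V → N} {F : Finset V}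
    (h : ∀ v ∈ F, c (F.erase v) = c' (F.erase v)) : koszulD x c F = koszulD x c' F := by
  simp only [koszulD_apply]
  exact Finset.sum_congr rfl fun v hv => by rw [h v hv]

theorem koszulD_map {N' : Type*} [AddCommGroup N'] [Module R N'] (f : N →ₗ[R] N') (x : V → R)
    (c : Finset V → N) (F : Finset V) : koszulD x (fun G => f (c G)) F = f (koszulD x c F) := by
  simp [koszulD_apply]

theorem koszulD_mem (x : V → R) (P : Submodule R N) {c : Finset V → N} {F : Finset V}
    (h : ∀ v ∈ F, c (F.erase v) ∈ P) : koszulD x c F ∈ P :=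
  P.sum_mem fun v hv => P.smul_mem _ (h v hv)

variable (R) in
/-- Contraction of cochains with the basis vector of index `v`. -/
def contract (v : V) : (Finset V → N) →ₗ[R] (Finset V → N) where
  toFun c F := if v ∈ F then 0 else (-1 : R) ^ (F.filter (· < v)).card • c (insert v F)
  map_add' c c' := by
    ext F
    by_cases h : v ∈ F <;> simp [h]
  map_smul' r c := by
    ext F
    by_cases h : v ∈ F
    · simp [h]
    · simp only [h, Pi.smul_apply, RingHom.id_apply, if_false]
      exact smul_comm _ _ _

theorem contract_of_mem {v : V} {F : Finset V} (h : v ∈ F) (c : Finset V → N) :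
    contract R v c F = 0 := if_pos h

theorem contract_of_notMem {v : V} {F : Finset V} (h : v ∉ F) (c : Finset V → N) :
    contract R v c F = (-1 : R) ^ (F.filter (· < v)).card • c (insert v F) := if_neg h

/-- Cartan's homotopy formula. For `v ∈ F` only the summand of `v` survives; for `v ∉ F` that
summand gives the right-hand side and the others cancel by sign. -/
theorem contract_koszulD (x : V → R) (v : V) (c : Finset V → N) (F : Finset V) :
    contract R v (koszulD x c) F + koszulD x (contract R v c) F = x v • c F := by
  by_cases h : v ∈ F
  · rw [contract_of_mem h, zero_add, koszulD_apply, Finset.sum_eq_single v]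
    · rw [contract_of_notMem (Finset.notMem_erase v F), Finset.insert_erase h, smul_smul,
        Finset.filter_erase, Finset.erase_eq_of_notMem (by simp), mul_right_comm, ← mul_pow]
      simp
    · intro w _ hwv
      rw [contract_of_mem (Finset.mem_erase.mpr ⟨hwv.symm, h⟩), smul_zero]
    · exact fun h' => absurd h h'
  · rw [contract_of_notMem h, koszulD_apply, Finset.sum_insert h, smul_add, smul_smul,
      Finset.erase_insert h, Finset.filter_insert, if_neg (lt_irrefl v), ← mul_assoc, ← mul_pow,
      add_assoc, Finset.smul_sum, koszulD_apply, ← Finset.sum_add_distrib, Finset.sum_eq_zero]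
    · simp
    · intro w hw
      have hvw : v ≠ w := fun e => h (e ▸ hw)
      rw [contract_of_notMem (fun h' => h (Finset.mem_of_mem_erase h')),
        Finset.erase_insert_of_ne hvw, smul_smul, smul_smul, ← add_smul]
      convert! zero_smul R _
      rcases lt_or_gt_of_ne hvw with hlt | hlt
      · rw [Finset.filter_insert, if_pos hlt, Finset.card_insert_of_notMem (by simp [h]),
          Finset.filter_erase, Finset.erase_eq_of_notMem (by simp [hlt.le]), pow_succ]
        ring
      · rw [Finset.filter_insert, if_neg hlt.not_gt, Finset.filter_erase,
          ← Finset.card_erase_add_one (s := F.filter (· < v)) (a := w) (by simp [hw, hlt]),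
          pow_succ]
        ring

theorem koszulD_insert (x : V → R) {v : V} {F : Finset V} (h : v ∉ F) (c : Finset V → N) :
    koszulD x c (insert v F) = (-1 : R) ^ (F.filter (· < v)).card •
      (x v • c F - koszulD x (contract R v c) F) := by
  rw [← contract_koszulD, add_sub_cancel_right, contract_of_notMem h, smul_smul, ← mul_pow]
  simp

/-- By the Cartan formula, contraction and differential anticommute up to a scalar, so the value on
`insert v F` reduces to values on `F`, without pairing off signs. -/
theorem koszulD_koszulD (x : V → R) (c : Finset V → N) (F : Finset V) :
    koszulD x (koszulD x c) F = 0 := by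
  induction F using Finset.induction_on generalizing c with
  | empty => simp [koszulD_apply]
  | insert v F h ih =>
    rw [koszulD_insert x h]
    have e : contract R v (koszulD x c) = x v • c - koszulD x (contract R v c) := by
      ext G
      rw [Pi.sub_apply, Pi.smul_apply, ← contract_koszulD, add_sub_cancel_right]
    rw [e, map_sub, map_smul, Pi.sub_apply, ih, sub_zero, Pi.smul_apply, sub_self, smul_zero]

end Koszul

/-! ### Links, deletions, purity and change of coefficients -/

section Acyclic

set_option linter.unusedSectionVars false

variable {V : Type*} [LinearOrder V]

/-- Vanishing of the reduced simplicial cohomology of `Δ` with coefficients in `L` at the faces with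
`n` vertices, that is, in degree `n - 1`. -/
def AcyclicAt (L : Type*) [CommRing L] (Δ : Set (Finset V)) (n : ℕ) : Prop :=
  ∀ c : Finset V → L, (∀ F ∈ Δ, F.card = n + 1 → koszulD (1 : V → L) c F = 0) →
    ∃ b : Finset V → L, ∀ F ∈ Δ, F.card = n → koszulD (1 : V → L) b F = c F

/-- The link of `G` in a family of finite sets. -/
def lk (Δ : Set (Finset V)) (G : Finset V) : Set (Finset V) := {F | Disjoint G F ∧ G ∪ F ∈ Δ}

/-- The members of `Δ` which avoid `G`. -/
def del (Δ : Set (Finset V)) (G : Finset V) : Set (Finset V) := {F | Disjoint G F ∧ F ∈ Δ}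

variable {Δ : Set (Finset V)}

theorem mem_lk_singleton {v : V} {F : Finset V} :
    F ∈ lk Δ {v} ↔ v ∉ F ∧ insert v F ∈ Δ := by
  simp [lk]

theorem mem_del_singleton {v : V} {F : Finset V} : F ∈ del Δ {v} ↔ v ∉ F ∧ F ∈ Δ := by
  simp [del]

theorem isLowerSet_lk (h : IsLowerSet Δ) (G : Finset V) : IsLowerSet (lk Δ G) :=
  fun _ _ hle hF => ⟨hF.1.mono_right hle, h (Finset.union_subset_union_right hle) hF.2⟩

theorem isLowerSet_del (h : IsLowerSet Δ) (G : Finset V) : IsLowerSet (del Δ G) :=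
  fun _ _ hle hF => ⟨hF.1.mono_right hle, h hle hF.2⟩

theorem lk_empty : lk Δ ∅ = Δ := by simp [lk]

theorem del_empty : del Δ ∅ = Δ := by simp [del]

theorem lk_lk_singleton {v : V} {G : Finset V} (hv : v ∉ G) :
    lk (lk Δ {v}) G = lk Δ (insert v G) := by
  ext F
  simp only [lk, Set.mem_ofPred_eq, Finset.disjoint_singleton_left, Finset.mem_union,
    Finset.insert_eq v G, Finset.union_assoc, Finset.disjoint_union_left]
  tauto

theorem lk_del_lk {v : V} {G H : Finset V} (hG : v ∉ G) (hH : v ∉ H) :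
    lk (del (lk Δ G) H) {v} = del (lk Δ (insert v G)) H := by
  ext F
  have e : G ∪ insert v F = insert v G ∪ F := by
    ext w
    simp only [Finset.mem_union, Finset.mem_insert]
    tauto
  rw [mem_lk_singleton]
  simp only [lk, del, Set.mem_ofPred_eq, Finset.disjoint_insert_left,
    Finset.disjoint_insert_right, e]
  tauto

theorem del_del_singleton {v : V} {H : Finset V} :
    del (del Δ H) {v} = del Δ (insert v H) := by
  ext F
  rw [mem_del_singleton]
  simp only [del, Set.mem_ofPred_eq, Finset.disjoint_insert_left]
  tauto

theorem lk_eq_empty (h : IsLowerSet Δ) {G : Finset V} (hG : G ∉ Δ) : lk Δ G = ∅ :=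
  Set.eq_empty_of_forall_notMem fun _ hF => hG (h Finset.subset_union_left hF.2)

variable {L : Type*} [CommRing L]

theorem acyclicAt_empty (n : ℕ) : AcyclicAt L (∅ : Set (Finset V)) n :=
  fun _ _ => ⟨0, fun _ h => absurd h (Set.notMem_empty _)⟩

theorem lk_subset (h : IsLowerSet Δ) (G : Finset V) : lk Δ G ⊆ Δ :=
  fun _ hF => h Finset.subset_union_right hF.2

theorem koszulD_one_insert {v : V} {F : Finset V} (h : v ∉ F) (c : Finset V → L) :
    koszulD (1 : V → L) c (insert v F) = (-1 : L) ^ (F.filter (· < v)).card *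
      (c F - koszulD (1 : V → L) (contract L v c) F) := by
  simpa using koszulD_insert (1 : V → L) h c

/-- The cochain which is `b` on the sets avoiding `v`, and whose contraction with `v` is `c`. -/
def glue (v : V) (b c : Finset V → L) (F : Finset V) : L :=
  if v ∈ F then (-1 : L) ^ ((F.erase v).filter (· < v)).card * c (F.erase v) else b F

theorem glue_of_notMem {v : V} {F : Finset V} (h : v ∉ F) (b c : Finset V → L) :
    glue v b c F = b F := if_neg h

theorem glue_insert {v : V} {F : Finset V} (h : v ∉ F) (b c : Finset V → L) :
    glue v b c (insert v F) = (-1 : L) ^ (F.filter (· < v)).card * c F := by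
  rw [glue, if_pos (Finset.mem_insert_self _ _), Finset.erase_insert h]

theorem contract_glue {v : V} {F : Finset V} (h : v ∉ F) (b c : Finset V → L) :
    contract L v (glue v b c) F = c F := by
  rw [contract_of_notMem h, glue_insert h, smul_eq_mul, ← mul_assoc, ← mul_pow]
  simp

theorem koszulD_glue_of_notMem {v : V} {F : Finset V} (h : v ∉ F) (b c : Finset V → L) :
    koszulD (1 : V → L) (glue v b c) F = koszulD (1 : V → L) b F :=
  koszulD_congr _ fun _ _ => glue_of_notMem (fun h' => h (Finset.mem_of_mem_erase h')) _ _

theorem koszulD_glue_insert {v : V} {F : Finset V} (h : v ∉ F) (b c : Finset V → L) :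
    koszulD (1 : V → L) (glue v b c) (insert v F) = (-1 : L) ^ (F.filter (· < v)).card *
      (b F - koszulD (1 : V → L) c F) := by
  rw [koszulD_one_insert h, glue_of_notMem h]
  congr 2
  exact koszulD_congr _ fun _ _ => contract_glue (fun h' => h (Finset.mem_of_mem_erase h')) _ _

/-- Exactness of H(Δ) → H(del) → H(lk): a cocycle on the deletion becomes a coboundary on the link,
and a primitive there is what is needed to extend it over the faces containing `v`. -/
theorem AcyclicAt.del_singleton (hΔ : IsLowerSet Δ) {v : V} {n : ℕ} (h : AcyclicAt L Δ n)
    (hlk : AcyclicAt L (lk Δ {v}) n) : AcyclicAt L (del Δ {v}) n := by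
  intro c hc
  obtain ⟨b, hb⟩ := hlk c fun F hF hn => hc F
    (mem_del_singleton.mpr ⟨(mem_lk_singleton.mp hF).1, lk_subset hΔ _ hF⟩) hn
  obtain ⟨e, he⟩ := h (glue v c b) fun F hF hn => by
    by_cases hv : v ∈ F
    · have hv' : v ∉ F.erase v := Finset.notMem_erase _ _
      rw [← Finset.insert_erase hv, koszulD_glue_insert hv', hb, sub_self, mul_zero]
      · exact mem_lk_singleton.mpr ⟨hv', by rwa [Finset.insert_erase hv]⟩
      · rw [Finset.card_erase_of_mem hv, hn, Nat.add_sub_cancel]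
    · rw [koszulD_glue_of_notMem hv]
      exact hc F (mem_del_singleton.mpr ⟨hv, hF⟩) hn
  refine ⟨e, fun F hF hn => ?_⟩
  obtain ⟨hv, hF⟩ := mem_del_singleton.mp hF
  rw [he F hF hn, glue_of_notMem hv]

/-- The connecting map of the same sequence: a cocycle on the link, placed on the faces containing
`v` and extended by zero, is a cocycle of Δ one degree higher. -/
theorem AcyclicAt.lk_singleton (hΔ : IsLowerSet Δ) {v : V} {n : ℕ} (h : AcyclicAt L Δ (n + 1))
    (hdel : AcyclicAt L (del Δ {v}) n) : AcyclicAt L (lk Δ {v}) n := by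
  intro c hc
  obtain ⟨b, hb⟩ := h (glue v 0 c) fun F hF hn => by
    by_cases hv : v ∈ F
    · have hv' : v ∉ F.erase v := Finset.notMem_erase _ _
      rw [← Finset.insert_erase hv, koszulD_glue_insert hv', hc, Pi.zero_apply, sub_self, mul_zero]
      · exact mem_lk_singleton.mpr ⟨hv', by rwa [Finset.insert_erase hv]⟩
      · rw [Finset.card_erase_of_mem hv, hn, Nat.add_sub_cancel]
    · rw [koszulD_glue_of_notMem hv, map_zero, Pi.zero_apply]
  obtain ⟨e, he⟩ := hdel b fun F hF hn => by
    obtain ⟨hv, hF⟩ := mem_del_singleton.mp hF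
    rw [hb F hF hn, glue_of_notMem hv, Pi.zero_apply]
  -- On the link, the differential of `contract L v b` is `b - c`, while that of `e` is `b`.
  refine ⟨e - contract L v b, fun F hF hn => ?_⟩
  obtain ⟨hv, hF'⟩ := mem_lk_singleton.mp hF
  have h1 := hb (insert v F) hF' (by rw [Finset.card_insert_of_notMem hv, hn])
  rw [koszulD_one_insert hv, glue_insert hv] at h1
  have h2 := he F (mem_del_singleton.mpr ⟨hv, lk_subset hΔ _ hF⟩) hn
  rw [map_sub, Pi.sub_apply, h2]
  exact (isUnit_one.neg.pow _).mul_left_cancel h1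

/-- Mixed complexes, a deletion of a link, make the induction on `H` close up: the link of `v` in
such a complex is again one, with `v` moved into `G`. -/
theorem acyclicAt_del_lk_of_lk (hΔ : IsLowerSet Δ) {d : ℕ}
    (h : ∀ (G : Finset V) (n : ℕ), n + G.card < d → AcyclicAt L (lk Δ G) n)
    (H : Finset V) : ∀ (G : Finset V) (n : ℕ), Disjoint G H → n + G.card + H.card < d →
      AcyclicAt L (del (lk Δ G) H) n := by
  induction H using Finset.induction_on with
  | empty =>
    intro G n _ hn
    rw [del_empty]
    exact h G n hn
  | insert v H hv ih =>
    intro G n hGH hn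
    rw [Finset.card_insert_of_notMem hv] at hn
    obtain ⟨hvG, hGH⟩ := Finset.disjoint_insert_right.mp hGH
    rw [← del_del_singleton]
    refine AcyclicAt.del_singleton (isLowerSet_del (isLowerSet_lk hΔ _) _)
      (ih G n hGH (by omega)) ?_
    rw [lk_del_lk hvG hv]
    refine ih _ n (Finset.disjoint_insert_left.mpr ⟨hv, hGH⟩) ?_
    rw [Finset.card_insert_of_notMem hvG]
    omega

theorem acyclicAt_del_lk_of_del (hΔ : IsLowerSet Δ) {d : ℕ}
    (h : ∀ (H : Finset V) (n : ℕ), n + H.card < d → AcyclicAt L (del Δ H) n)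
    (G : Finset V) : ∀ (H : Finset V) (n : ℕ), Disjoint G H → n + G.card + H.card < d →
      AcyclicAt L (del (lk Δ G) H) n := by
  induction G using Finset.induction_on with
  | empty =>
    intro H n _ hn
    rw [lk_empty]
    exact h H n hn
  | insert v G hv ih =>
    intro H n hGH hn
    rw [Finset.card_insert_of_notMem hv] at hn
    obtain ⟨hvH, hGH⟩ := Finset.disjoint_insert_left.mp hGH
    rw [← lk_del_lk hv hvH]
    refine AcyclicAt.lk_singleton (isLowerSet_del (isLowerSet_lk hΔ _) _)
      (ih H (n + 1) hGH (by omega)) ?_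
    rw [del_del_singleton]
    refine ih _ n (Finset.disjoint_insert_right.mpr ⟨hv, hGH⟩) ?_
    rw [Finset.card_insert_of_notMem hvH]
    omega

/-- Both families are extreme cases, `H = ∅` and `G = ∅`, of the mixed family with the bound `n +
|G| + |H| < d`. -/
theorem acyclicAt_lk_iff_del (hΔ : IsLowerSet Δ) (d : ℕ) :
    (∀ (G : Finset V) (n : ℕ), n + G.card < d → AcyclicAt L (lk Δ G) n) ↔
      ∀ (H : Finset V) (n : ℕ), n + H.card < d → AcyclicAt L (del Δ H) n := by
  refine ⟨fun h H n hn => ?_, fun h G n hn => ?_⟩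
  · simpa only [lk_empty] using
      acyclicAt_del_lk_of_lk hΔ h H ∅ n (Finset.disjoint_empty_left H) (by simpa using hn)
  · simpa only [del_empty] using
      acyclicAt_del_lk_of_del hΔ h G ∅ n (Finset.disjoint_empty_right G) (by simpa using hn)

/-- Every link has vanishing reduced cohomology below its dimension. -/
def LinksAcyclic (L : Type*) [CommRing L] (Δ : Set (Finset V)) : Prop :=
  ∀ G ∈ Δ, ∀ F ∈ lk Δ G, ∀ n < F.card, AcyclicAt L (lk Δ G) n

theorem LinksAcyclic.lk_singleton (h : LinksAcyclic L Δ) (v : V) :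
    LinksAcyclic L (lk Δ {v}) := by
  intro G hG
  obtain ⟨hv, hG⟩ := mem_lk_singleton.mp hG
  rw [lk_lk_singleton hv]
  exact h _ hG

theorem koszulD_one_pair (c : Finset V → L) {v w : V} (h : v ≠ w) :
    koszulD (1 : V → L) c {v, w} =
      (-1 : L) ^ (({w} : Finset V).filter (· < v)).card * (c {w} - c {v}) := by
  rw [koszulD_one_insert (by simpa using h)]
  simp [koszulD_apply, contract_of_notMem, Finset.filter_singleton]

/-- Purity. Faces through a vertex of a top-dimensional face are handled by induction in its link;
connectedness then shows that every vertex lies in a top-dimensional face. -/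
theorem LinksAcyclic.exists_superset_card_eq [Nontrivial L] (d : ℕ) :
    ∀ {Δ : Set (Finset V)}, IsLowerSet Δ → LinksAcyclic L Δ → (∀ F ∈ Δ, F.card ≤ d) →
      (∃ D ∈ Δ, D.card = d) → ∀ G ∈ Δ, ∃ D ∈ Δ, G ⊆ D ∧ D.card = d := by
  classical
  induction d with
  | zero =>
    intro Δ _ _ hle _ G hG
    exact ⟨G, hG, subset_rfl, Nat.le_zero.mp (hle G hG)⟩
  | succ d ih =>
    rintro Δ hΔ hL hle ⟨D, hD, hDc⟩ G hG
    have key : ∀ v, (∃ E ∈ Δ, v ∈ E ∧ E.card = d + 1) →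
        ∀ F ∈ Δ, v ∈ F → ∃ E ∈ Δ, F ⊆ E ∧ E.card = d + 1 := by
      rintro v ⟨E, hE, hvE, hEc⟩ F hF hvF
      obtain ⟨E', hE', hFE', hE'c⟩ := ih (isLowerSet_lk hΔ {v}) (hL.lk_singleton v)
        (fun T hT => by
          obtain ⟨hv, hT⟩ := mem_lk_singleton.mp hT
          have := hle _ hT
          rw [Finset.card_insert_of_notMem hv] at this
          omega)
        ⟨E.erase v, mem_lk_singleton.mpr ⟨Finset.notMem_erase _ _, by
          rwa [Finset.insert_erase hvE]⟩, by rw [Finset.card_erase_of_mem hvE, hEc]; rfl⟩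
        (F.erase v) (mem_lk_singleton.mpr ⟨Finset.notMem_erase _ _, by
          rwa [Finset.insert_erase hvF]⟩)
      obtain ⟨hv, hE'⟩ := mem_lk_singleton.mp hE'
      refine ⟨_, hE', ?_, by rw [Finset.card_insert_of_notMem hv, hE'c]⟩
      rw [← Finset.insert_erase hvF]
      exact Finset.insert_subset_insert _ hFE'
    have all : ∀ w, {w} ∈ Δ → ∃ E ∈ Δ, w ∈ E ∧ E.card = d + 1 := by
      intro w hw
      rcases Nat.eq_zero_or_pos d with rfl | hd
      · exact ⟨{w}, hw, Finset.mem_singleton_self w, by simp⟩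
      -- On vertices this is the indicator of lying in a face of full size. By `key` it is constant
      -- along edges, hence a cocycle, and vanishing in degree 0 makes it constant.
      let c : Finset V → L := fun F => if ∃ E ∈ Δ, F ⊆ E ∧ E.card = d + 1 then 1 else 0
      have hac : AcyclicAt L Δ 1 := by
        have := hL ∅ (hΔ (Finset.empty_subset D) hD) D (by rwa [lk_empty]) 1 (by omega)
        rwa [lk_empty] at this
      obtain ⟨b, hb⟩ := hac c fun F hF hF2 => by
        obtain ⟨x, y, hxy, rfl⟩ := Finset.card_eq_two.mp hF2
        have aux : ∀ x y, {x, y} ∈ Δ → (∃ E ∈ Δ, {x} ⊆ E ∧ E.card = d + 1) →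
            ∃ E ∈ Δ, {y} ⊆ E ∧ E.card = d + 1 := by
          rintro x y hxy ⟨E, hE, hxE, hEc⟩
          obtain ⟨E', hE', hs, hc'⟩ := key x ⟨E, hE, by simpa using hxE, hEc⟩ _ hxy (by simp)
          exact ⟨E', hE', fun z hz => hs (Finset.mem_insert_of_mem hz), hc'⟩
        have : c {x} = c {y} :=
          if_congr ⟨aux x y hF, aux y x (by rwa [Finset.pair_comm])⟩ rfl rfl
        rw [koszulD_one_pair c hxy, this, sub_self, mul_zero]
      have hconst : ∀ z, {z} ∈ Δ → c {z} = b ∅ := by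
        intro z hz
        rw [← hb {z} hz (Finset.card_singleton z)]
        simp [koszulD_apply, Finset.filter_singleton]
      obtain ⟨u, hu⟩ := Finset.card_pos.mp (by omega : 0 < D.card)
      have huD : {u} ⊆ D := Finset.singleton_subset_iff.mpr hu
      have h1 : c {w} = 1 := by
        rw [hconst w hw, ← hconst u (hΔ huD hD)]
        exact if_pos ⟨D, hD, huD, hDc⟩
      by_contra hno
      refine zero_ne_one (α := L) ?_
      rw [← h1]
      refine (if_neg ?_).symm
      rintro ⟨E, hE, hwE, hEc⟩
      exact hno ⟨E, hE, Finset.singleton_subset_iff.mp hwE, hEc⟩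
    rcases G.eq_empty_or_nonempty with rfl | ⟨w, hw⟩
    · exact ⟨D, hD, Finset.empty_subset _, hDc⟩
    · exact key w (all w (hΔ (Finset.singleton_subset_iff.mpr hw) hG)) G hG hw

/-- Purity gives the link of a face `G` a face with `d - |G|` vertices, so the uniform bound lies
below its dimension. If `G` is not a face, its link is empty. -/
theorem LinksAcyclic.acyclicAt_lk [Nontrivial L] (hΔ : IsLowerSet Δ) (h : LinksAcyclic L Δ)
    {d : ℕ} (hle : ∀ F ∈ Δ, F.card ≤ d) (hD : ∃ D ∈ Δ, D.card = d) (G : Finset V) (n : ℕ)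
    (hn : n + G.card < d) : AcyclicAt L (lk Δ G) n := by
  by_cases hG : G ∈ Δ
  · obtain ⟨D, hD, hGD, hc⟩ := h.exists_superset_card_eq d hΔ hle hD G hG
    refine h G hG (D \ G) ⟨Finset.disjoint_sdiff, ?_⟩ n ?_
    · rwa [Finset.union_sdiff_of_subset hGD]
    · rw [Finset.card_sdiff_of_subset hGD]
      omega
  · rw [lk_eq_empty hΔ hG]
    exact acyclicAt_empty n

/-- Acyclicity over a field passes to all commutative algebras over it. -/
theorem AcyclicAt.baseChange {k : Type*} [Field k] [Algebra k L] [Fintype V] {n : ℕ}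
    (h : AcyclicAt k Δ n) : AcyclicAt L Δ n := by
  classical
  intro c hc
  let B := Module.Basis.ofVectorSpace k L
  have hD : ∀ (l : Finset V → L) (F : Finset V) i,
      B.repr (koszulD (1 : V → L) l F) i = koszulD (1 : V → k) (fun G => B.repr (l G) i) F := by
    intro l F i
    have : koszulD (1 : V → L) l F = koszulD (1 : V → k) l F := by
      simp only [koszulD_apply, Pi.one_apply, mul_one]
      refine Finset.sum_congr rfl fun v _ => ?_
      rcases neg_one_pow_eq_or k (F.filter (· < v)).card with e | e <;>
      rcases Nat.even_or_odd (F.filter (· < v)).card with e' | e' <;> simp [e'.neg_one_pow]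
    rw [this, ← Module.Basis.coord_apply, ← koszulD_map]
    rfl
  have hi : ∀ i, ∃ b : Finset V → k, ∀ F ∈ Δ, F.card = n →
      koszulD (1 : V → k) b F = B.repr (c F) i := fun i =>
    h (fun F => B.repr (c F) i) fun F hF hn => by rw [← hD, hc F hF hn]; simp
  choose b hb using hi
  -- Primitives are found coordinate by coordinate. Only finitely many coordinates matter because
  -- `V` is finite; outside `T` all coordinates of `c` vanish.
  let T : Finset _ := Finset.univ.biUnion fun F : Finset V => (B.repr (c F)).support
  refine ⟨fun F => ∑ i ∈ T, b i F • B i, fun F hF hn => B.repr.injective ?_⟩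
  ext i
  rw [hD]
  have e : ∀ G, B.repr (∑ j ∈ T, b j G • B j) i = if i ∈ T then b i G else 0 := by
    intro G
    simp [map_sum, Finsupp.single_apply]
  simp only [e]
  by_cases hiT : i ∈ T
  · simp only [hiT, if_true]
    exact hb i F hF hn
  · simp only [hiT, if_false]
    rw [show (fun _ : Finset V => (0 : k)) = 0 from rfl, map_zero, Pi.zero_apply]
    by_contra hne
    exact hiT (Finset.mem_biUnion.mpr ⟨F, Finset.mem_univ _,
      Finsupp.mem_support_iff.mpr (Ne.symm hne)⟩)

end Acyclic

/-! ### Reduced homology in terms of cochains -/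

section Homology

set_option linter.unusedSectionVars false

variable {V : Type u} [LinearOrder V] {k : Type v} [Field k]

theorem isLowerSet_faceSet (K : PreAbstractSimplicialComplex V) : IsLowerSet (faceSet K) :=
  fun _ _ hle hs => mem_faceSet_of_subset K hs hle

theorem faceSet_link (K : PreAbstractSimplicialComplex V) {σ : Finset V} (hσ : σ ∈ faceSet K) :
    faceSet (link K σ) = lk (faceSet K) σ := by
  ext τ
  constructor
  · rintro (rfl | h)
    · exact ⟨Finset.disjoint_empty_right σ, by rwa [Finset.union_empty]⟩
    · exact h.2
  · intro h
    rcases τ.eq_empty_or_nonempty with rfl | hτ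
    · exact Or.inl rfl
    · exact Or.inr ⟨hτ, h⟩

theorem lt_dim_iff [Fintype V] (K : PreAbstractSimplicialComplex V) (n : ℕ) :
    (n : ℤ) - 1 < dim K ↔ ∃ F ∈ faceSet K, n < F.card := by
  classical
  rw [dim, sub_lt_sub_iff_right, Nat.cast_lt, Finset.lt_sup_iff]
  simp

theorem isZero_reducedHomology_iff_exact (K : PreAbstractSimplicialComplex V) (i : ℤ) :
    CategoryTheory.Limits.IsZero (reducedHomology k K i) ↔
      LinearMap.range (boundary k K (i + 1) i) = LinearMap.ker (boundary k K i (i - 1)) := by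
  rw [reducedHomology, ← HomologicalComplex.exactAt_iff_isZero_homology,
    HomologicalComplex.exactAt_iff' _ (i + 1) i (i - 1) (ChainComplex.prev ℤ i)
      (ChainComplex.next ℤ i), CategoryTheory.ShortComplex.moduleCat_exact_iff_range_eq_ker]
  rfl

theorem isZero_reducedHomology_of_lt (K : PreAbstractSimplicialComplex V) {i : ℤ} (hi : i < -1) :
    CategoryTheory.Limits.IsZero (reducedHomology k K i) := by
  rw [isZero_reducedHomology_iff_exact]
  have : IsEmpty {s : Finset V // s ∈ faceSet K ∧ (s.card : ℤ) = i + 1} :=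
    ⟨fun s => by have := s.2.2; omega⟩
  exact Subsingleton.elim _ _

/-- Over a field, dualizing exchanges kernels and ranges through annihilators, and a subspace is
determined by its annihilator. -/
theorem range_eq_ker_iff_dual {A B C : Type*} [AddCommGroup A] [Module k A] [AddCommGroup B]
    [Module k B] [AddCommGroup C] [Module k C] (f : A →ₗ[k] B) (g : B →ₗ[k] C) :
    LinearMap.range f = LinearMap.ker g ↔
      LinearMap.range g.dualMap = LinearMap.ker f.dualMap := by
  rw [LinearMap.range_dualMap_eq_dualAnnihilator_ker, LinearMap.ker_dualMap_eq_dualAnnihilator_range,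
    Subspace.dualAnnihilator_inj, eq_comm]

theorem dual_boundary_single (K : PreAbstractSimplicialComplex V) (i j : ℤ)
    (φ : Module.Dual k (Chains k K j)) (s) :
    φ (boundary k K i j (Finsupp.single s 1)) =
      koszulD (1 : V → k) (fun t => φ (basisChain k K j t)) s.1 := by
  simp [boundary, koszulD_apply]

/-- The cochain on the faces of a complex given by a function on all finite sets. -/
noncomputable def cochain (K : PreAbstractSimplicialComplex V) (i : ℤ) (c : Finset V → k) :
    Module.Dual k (Chains k K i) :=
  Finsupp.linearCombination k fun s => c s.1

theorem cochain_single (K : PreAbstractSimplicialComplex V) (i : ℤ) (c : Finset V → k) (s) :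
    cochain K i c (Finsupp.single s 1) = c s.1 := by
  simp [cochain]

theorem cochain_basisChain (K : PreAbstractSimplicialComplex V) {i : ℤ} (c : Finset V → k)
    {t : Finset V} (ht : t ∈ faceSet K) (hc : (t.card : ℤ) = i + 1) :
    cochain K i c (basisChain k K i t) = c t := by
  rw [basisChain, dif_pos ⟨ht, hc⟩, cochain_single]

theorem cochain_boundary_single (K : PreAbstractSimplicialComplex V) {i j : ℤ} (hij : j + 1 = i)
    (c : Finset V → k) (s) : cochain K j c (boundary k K i j (Finsupp.single s 1)) =
      koszulD (1 : V → k) c s.1 := by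
  rw [dual_boundary_single]
  refine koszulD_congr _ fun v hv => cochain_basisChain K c
    (mem_faceSet_of_subset K s.2.1 (Finset.erase_subset _ _)) ?_
  have h3 := Finset.card_erase_add_one hv
  have h4 := s.2.2
  omega

/-- The dual of the boundary is the Koszul differential with all coefficients 1. A cochain may be
any function on finite sets, since only its values on faces enter. -/
theorem isZero_reducedHomology_iff (K : PreAbstractSimplicialComplex V) (n : ℕ) :
    CategoryTheory.Limits.IsZero (reducedHomology k K (n - 1)) ↔ AcyclicAt k (faceSet K) n := by
  rw [isZero_reducedHomology_iff_exact, range_eq_ker_iff_dual]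
  set f := boundary k K ((n : ℤ) - 1 + 1) (n - 1) with hf
  set g := boundary k K ((n : ℤ) - 1) (n - 1 - 1) with hg
  have hle : LinearMap.range g.dualMap ≤ LinearMap.ker f.dualMap := by
    rintro _ ⟨φ, rfl⟩
    rw [LinearMap.mem_ker]
    refine LinearMap.ext fun x => ?_
    have := boundary_comp k K ((n : ℤ) - 1 + 1) (n - 1) (n - 1 - 1) rfl
    exact (congrArg φ (LinearMap.congr_fun this x)).trans (map_zero φ)
  constructor
  · intro h c hc
    have hker : cochain K _ c ∈ LinearMap.ker f.dualMap := by
      rw [LinearMap.mem_ker]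
      refine Finsupp.lhom_ext' fun s => LinearMap.ext_ring ?_
      change cochain K _ c (f (Finsupp.single s 1)) = 0
      rw [hf, cochain_boundary_single K rfl]
      exact hc s.1 s.2.1 (by have := s.2.2; omega)
    rw [← h] at hker
    obtain ⟨φ, hφ⟩ := hker
    refine ⟨fun t => φ (basisChain k K _ t), fun F hF hn => ?_⟩
    have := LinearMap.congr_fun hφ (Finsupp.single ⟨F, hF, by omega⟩ 1)
    rw [cochain_single, LinearMap.dualMap_apply, hg, dual_boundary_single] at this
    exact this
  · intro h
    refine le_antisymm hle fun φ hφ => ?_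
    obtain ⟨b, hb⟩ := h (fun t => φ (basisChain k K _ t)) fun F hF hn => by
      rw [← dual_boundary_single K ((n : ℤ) - 1 + 1) (n - 1) φ ⟨F, hF, by omega⟩]
      exact LinearMap.congr_fun hφ _
    refine ⟨cochain K _ b, Finsupp.lhom_ext' fun s => LinearMap.ext_ring ?_⟩
    change cochain K _ b (g (Finsupp.single s 1)) = φ (Finsupp.single s 1)
    rw [hg, cochain_boundary_single K (by ring), hb s.1 s.2.1 (by have := s.2.2; omega),
      basisChain, dif_pos s.2]

theorem forall_isZero_reducedHomology_iff [Fintype V] (K : PreAbstractSimplicialComplex V) :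
    (∀ i : ℤ, i < dim K → CategoryTheory.Limits.IsZero (reducedHomology k K i)) ↔
      ∀ F ∈ faceSet K, ∀ n < F.card, AcyclicAt k (faceSet K) n := by
  constructor
  · intro h F hF n hn
    exact (isZero_reducedHomology_iff K n).mp (h _ ((lt_dim_iff K n).mpr ⟨F, hF, hn⟩))
  · intro h i hi
    rcases lt_or_ge i (-1) with hi' | hi'
    · exact isZero_reducedHomology_of_lt K hi'
    · obtain ⟨n, hn⟩ := Int.eq_ofNat_of_zero_le (by omega : 0 ≤ i + 1)
      obtain rfl : i = (n : ℤ) - 1 := by omega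
      obtain ⟨F, hF, hn⟩ := (lt_dim_iff K n).mp hi
      exact (isZero_reducedHomology_iff K n).mpr (h F hF n hn)

theorem forall_isZero_link_iff [Fintype V] (K : PreAbstractSimplicialComplex V) :
    (∀ σ ∈ faceSet K, ∀ i : ℤ, i < dim (link K σ) →
      CategoryTheory.Limits.IsZero (reducedHomology k (link K σ) i)) ↔
      LinksAcyclic k (faceSet K) := by
  refine forall₂_congr fun σ hσ => ?_
  rw [forall_isZero_reducedHomology_iff, faceSet_link K hσ]

end Homology

/-! ### The Stanley–Reisner ideal as a monomial ideal -/

section FaceIdeal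

variable {V : Type*} (L : Type*) [CommRing L]

/-- The ideal of the polynomial ring generated by the squarefree monomials whose support is not in
`Δ`. -/
noncomputable def faceIdeal (Δ : Set (Finset V)) : Ideal (MvPolynomial V L) :=
  Ideal.span {p | ∃ s : Finset V, s ∉ Δ ∧ p = ∏ i ∈ s, MvPolynomial.X i}

/-- The exponent of the squarefree monomial with support `F`. -/
noncomputable def ind (F : Finset V) : V →₀ ℕ := ∑ i ∈ F, Finsupp.single i 1

theorem ind_apply [DecidableEq V] (F : Finset V) (v : V) : ind F v = if v ∈ F then 1 else 0 := by
  simp [ind, Finsupp.finsetSum_apply, Finsupp.single_apply]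

variable {L}

theorem mem_faceIdeal_iff {Δ : Set (Finset V)} (hΔ : IsLowerSet Δ) {p : MvPolynomial V L} :
    p ∈ faceIdeal L Δ ↔ ∀ m : V →₀ ℕ, m.support ∈ Δ → p.coeff m = 0 := by
  classical
  have e : {p : MvPolynomial V L | ∃ s : Finset V, s ∉ Δ ∧ p = ∏ i ∈ s, MvPolynomial.X i} =
      (fun m => MvPolynomial.monomial m 1) '' {m | ∃ s : Finset V, s ∉ Δ ∧ m = ind s} := by
    ext p
    constructor
    · rintro ⟨s, hs, rfl⟩
      exact ⟨ind s, ⟨s, hs, rfl⟩, by simp [ind, MvPolynomial.monomial_sum_one, MvPolynomial.X]⟩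
    · rintro ⟨_, ⟨s, hs, rfl⟩, rfl⟩
      exact ⟨s, hs, by simp [ind, MvPolynomial.monomial_sum_one, MvPolynomial.X]⟩
  rw [faceIdeal, e, MvPolynomial.mem_ideal_span_monomial_image]
  refine forall_congr' fun m => ?_
  rw [MvPolynomial.mem_support_iff, ← not_imp_not, not_not, iff_iff_eq]
  congr 1
  rw [eq_iff_iff, not_exists, ← not_iff_not, not_forall]
  constructor
  · rintro ⟨x, hx⟩ hm
    obtain ⟨⟨s, hs, rfl⟩, hle⟩ := not_not.mp hx
    refine hs (hΔ ?_ hm)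
    intro v hv
    have := hle v
    rw [ind_apply, if_pos hv] at this
    exact Finsupp.mem_support_iff.mpr (by omega)
  · intro hm
    refine ⟨ind m.support, not_not.mpr ⟨⟨_, hm, rfl⟩, fun v => ?_⟩⟩
    rw [ind_apply]
    split_ifs with hv
    · exact Nat.one_le_iff_ne_zero.mpr (Finsupp.mem_support_iff.mp hv)
    · exact Nat.zero_le _

end FaceIdeal

/-! ### Signs for cochains supported on the sets containing a fixed set -/

section Twist

variable {V : Type*} [LinearOrder V] {L : Type*} [CommRing L]

variable (L) in
/-- The sign by which the differentials of `F` and `F ∪ G` differ. -/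
def twist (G F : Finset V) : L := ∏ v ∈ F, (-1 : L) ^ (G.filter (· < v)).card

theorem twist_mul_self (G F : Finset V) : twist L G F * twist L G F = 1 := by
  rw [twist, ← Finset.prod_mul_distrib]
  refine Finset.prod_eq_one fun v _ => ?_
  rw [← mul_pow]
  simp

theorem twist_erase (G : Finset V) {F : Finset V} {v : V} (hv : v ∈ F) :
    twist L G F = (-1 : L) ^ (G.filter (· < v)).card * twist L G (F.erase v) :=
  (Finset.mul_prod_erase F _ hv).symm

/-- Restriction of a cochain to the sets containing `G`, indexed by the complement of `G`. -/
def shiftDown (G : Finset V) (c : Finset V → L) (F : Finset V) : L := twist L G F * c (F ∪ G)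

/-- Extension by zero of a cochain, from the sets avoiding `G` to the sets containing `G`. -/
def shiftUp (G : Finset V) (b : Finset V → L) (F : Finset V) : L :=
  if G ⊆ F then twist L G (F \ G) * b (F \ G) else 0

theorem shiftUp_of_not_subset {G F : Finset V} (h : ¬ G ⊆ F) (b : Finset V → L) :
    shiftUp G b F = 0 := if_neg h

theorem shiftUp_union {G F : Finset V} (h : Disjoint F G) (b : Finset V → L) :
    shiftUp G b (F ∪ G) = twist L G F * b F := by
  rw [shiftUp, if_pos Finset.subset_union_right, Finset.union_sdiff_cancel_right h]

/-- The sign of `v` in `F ∪ G` differs from that in `F` by the number of elements of `G` below `v`,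
which `twist` absorbs. Erasing an element of `G` gives a set where `c` vanishes. -/
theorem koszulD_shiftDown {G : Finset V} {c : Finset V → L} (hc : ∀ F, ¬ G ⊆ F → c F = 0)
    {F : Finset V} (h : Disjoint F G) :
    koszulD (1 : V → L) (shiftDown G c) F =
      twist L G F * koszulD (1 : V → L) c (F ∪ G) := by
  rw [koszulD_apply, koszulD_apply, Finset.sum_union h, Finset.sum_eq_zero (s := G), add_zero,
    Finset.mul_sum]
  · refine Finset.sum_congr rfl fun v hv => ?_
    have hvG : v ∉ G := Finset.disjoint_left.mp h hv
    have e : (F ∪ G).erase v = F.erase v ∪ G := by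
      rw [Finset.erase_union_distrib, Finset.erase_eq_of_notMem hvG]
    rw [e, shiftDown, twist_erase G hv, Finset.filter_union, Finset.card_union_of_disjoint
      (Finset.disjoint_filter_filter h), pow_add]
    have : (-1 : L) ^ (G.filter (· < v)).card * (-1 : L) ^ (G.filter (· < v)).card = 1 := by
      rw [← mul_pow]
      simp
    simp only [Pi.one_apply, mul_one, smul_eq_mul]
    linear_combination (-(-1 : L) ^ (F.filter (· < v)).card * twist L G (F.erase v) *
      c (F.erase v ∪ G)) * this
  · intro v hv
    rw [hc _ fun h' => Finset.notMem_erase v _ (h' hv), smul_zero]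

theorem koszulD_shiftUp {G : Finset V} (b : Finset V → L) {F : Finset V} (h : Disjoint F G) :
    koszulD (1 : V → L) (shiftUp G b) (F ∪ G) = twist L G F * koszulD (1 : V → L) b F := by
  have h1 := koszulD_shiftDown (c := shiftUp G b) (fun _ h' => shiftUp_of_not_subset h' b) h
  have h2 : koszulD (1 : V → L) (shiftDown G (shiftUp G b)) F = koszulD (1 : V → L) b F := by
    refine koszulD_congr _ fun v _ => ?_
    rw [shiftDown, shiftUp_union (h.mono_left (Finset.erase_subset _ _)), ← mul_assoc,
      twist_mul_self, one_mul]
  rw [← h2, h1, ← mul_assoc, twist_mul_self, one_mul]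

end Twist

/-! ### Multigraded pieces of Koszul cohomology -/

section Hochster

set_option linter.unusedSectionVars false

variable {V : Type*} [LinearOrder V] [Fintype V] {L : Type*} [CommRing L]

/-- The component of multidegree `a - (1, …, 1)` of a Koszul cochain of the polynomial ring. -/
noncomputable def component (a : V →₀ ℕ) (c : Finset V → MvPolynomial V L) (F : Finset V) : L :=
  if Fᶜ ⊆ a.support then (c F).coeff (a - ind Fᶜ) else 0

theorem component_of_subset {a : V →₀ ℕ} {F : Finset V} (h : Fᶜ ⊆ a.support)
    (c : Finset V → MvPolynomial V L) : component a c F = (c F).coeff (a - ind Fᶜ) := if_pos h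

theorem component_of_not_subset {a : V →₀ ℕ} {F : Finset V} (h : ¬ Fᶜ ⊆ a.support)
    (c : Finset V → MvPolynomial V L) : component a c F = 0 := if_neg h

/-- Erasing `v` from `F` lowers the exponent `a - ind Fᶜ` by one at `v`, exactly the degree restored
by `X v`. -/
theorem component_koszulD (a : V →₀ ℕ) (c : Finset V → MvPolynomial V L) (F : Finset V) :
    component a (koszulD (R := MvPolynomial V L) MvPolynomial.X c) F =
      koszulD (1 : V → L) (component a c) F := by
  by_cases h : Fᶜ ⊆ a.support
  · rw [component_of_subset h, koszulD_apply, koszulD_apply, MvPolynomial.coeff_sum]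
    refine Finset.sum_congr rfl fun v hv => ?_
    have hC : ((-1 : MvPolynomial V L) ^ (F.filter (· < v)).card) =
        MvPolynomial.C ((-1 : L) ^ (F.filter (· < v)).card) := by simp
    rw [hC, smul_eq_mul, mul_assoc, MvPolynomial.coeff_C_mul, Pi.one_apply, mul_one, smul_eq_mul,
      MvPolynomial.coeff_X_mul']
    congr 1
    by_cases hva : v ∈ a.support
    · have hs : (F.erase v)ᶜ ⊆ a.support := by
        intro w hw
        by_cases hwv : w = v
        · exact hwv ▸ hva
        · exact h (by simpa [hwv] using hw)
      rw [component_of_subset hs, if_pos]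
      · congr 1
        ext w
        simp only [Finsupp.tsub_apply, ind_apply, Finset.mem_compl, Finset.mem_erase,
          Finsupp.single_apply]
        by_cases hwv : v = w
        · subst hwv
          simp [hv]
        · simp [hwv, Ne.symm hwv]
      · rw [Finsupp.mem_support_iff] at hva ⊢
        simpa [ind_apply, hv] using hva
    · rw [component_of_not_subset fun h' => hva (h' (by simp)), if_neg]
      rw [Finsupp.mem_support_iff, not_not] at hva ⊢
      simp [hva]
  · rw [component_of_not_subset h, koszulD_apply, Finset.sum_eq_zero]
    intro v hv
    rw [component_of_not_subset, smul_zero]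
    refine fun h' => h (subset_trans (fun w hw => ?_) h')
    rw [Finset.mem_compl] at hw ⊢
    exact fun h'' => hw (Finset.mem_of_mem_erase h'')

theorem add_ind_sub_ind (m : V →₀ ℕ) (F : Finset V) : m + ind F - ind F = m :=
  add_tsub_cancel_right m _

theorem subset_support_add_ind (m : V →₀ ℕ) (F : Finset V) : F ⊆ (m + ind F).support := by
  intro v hv
  simp [ind_apply, hv]

theorem sub_ind_inj {a a' : V →₀ ℕ} {F : Finset V} (h : F ⊆ a.support) (h' : F ⊆ a'.support)
    (e : a - ind F = a' - ind F) : a = a' := by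
  ext v
  have := DFunLike.congr_fun e v
  simp only [Finsupp.tsub_apply, ind_apply] at this
  split_ifs at this with hv
  · have h1 := Finsupp.mem_support_iff.mp (h hv)
    have h2 := Finsupp.mem_support_iff.mp (h' hv)
    omega
  · simpa using this

variable {Δ : Set (Finset V)}

theorem mem_faceIdeal_iff_component (hΔ : IsLowerSet Δ) (c : Finset V → MvPolynomial V L)
    (F : Finset V) : c F ∈ faceIdeal L Δ ↔
      ∀ a : V →₀ ℕ, Fᶜ ⊆ a.support → (a - ind Fᶜ).support ∈ Δ → component a c F = 0 := by
  rw [mem_faceIdeal_iff hΔ]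
  constructor
  · intro h a ha hm
    rw [component_of_subset ha]
    exact h _ hm
  · intro h m hm
    have := h (m + ind Fᶜ) (subset_support_add_ind m _) (by rwa [add_ind_sub_ind])
    rwa [component_of_subset (subset_support_add_ind m _), add_ind_sub_ind] at this

theorem component_sub (a : V →₀ ℕ) (c c' : Finset V → MvPolynomial V L) (F : Finset V) :
    component a (c - c') F = component a c F - component a c' F := by
  by_cases h : Fᶜ ⊆ a.support
  · simp [component_of_subset h]
  · simp [component_of_not_subset h]

/-- The Koszul cohomology of the variables on the quotient of the polynomial ring by the ideal `I`
vanishes in degree `i`. -/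
def KoszulVanishes (I : Ideal (MvPolynomial V L)) (i : ℕ) : Prop :=
  ∀ c : Finset V → MvPolynomial V L,
    (∀ F : Finset V, F.card = i + 1 → koszulD (R := MvPolynomial V L) MvPolynomial.X c F ∈ I) →
      ∃ b : Finset V → MvPolynomial V L,
        ∀ F : Finset V, F.card = i → (c - koszulD (R := MvPolynomial V L) MvPolynomial.X b) F ∈ I

/-- A Koszul cochain with prescribed components. -/
noncomputable def assemble (T : Finset (V →₀ ℕ)) (b : (V →₀ ℕ) → Finset V → L) (F : Finset V) :
    MvPolynomial V L :=
  ∑ a ∈ T, MvPolynomial.monomial (a - ind Fᶜ) (b a F)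

theorem component_assemble {T : Finset (V →₀ ℕ)} {b : (V →₀ ℕ) → Finset V → L}
    (hT : ∀ a ∉ T, b a = 0) (hb : ∀ a F, ¬ Fᶜ ⊆ a.support → b a F = 0) (a : V →₀ ℕ) :
    component a (assemble T b) = b a := by
  ext F
  by_cases h : Fᶜ ⊆ a.support
  · rw [component_of_subset h, assemble, MvPolynomial.coeff_sum]
    rw [Finset.sum_eq_single a]
    · rw [MvPolynomial.coeff_monomial, if_pos rfl]
    · intro a' _ hne
      rw [MvPolynomial.coeff_monomial]
      split_ifs with e
      · by_contra hne'
        exact hne (sub_ind_inj (not_not.mp (mt (hb a' F) hne')) h e)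
      · rfl
    · intro ha
      rw [hT a ha]
      simp
  · rw [component_of_not_subset h, hb a F h]

theorem support_sub_ind_of_le_one {a : V →₀ ℕ} (h1 : ∀ v, a v ≤ 1) (F : Finset V) :
    (a - ind Fᶜ).support = F \ a.supportᶜ := by
  ext v
  have := h1 v
  by_cases hv : v ∈ F <;> simp [ind_apply, hv]
  omega

/-- This is Hochster's dichotomy: an exponent at least 2 makes the component contractible; otherwise
it is the shifted cochain complex of the deletion of the zero set of `a`. -/
theorem exists_primitive_component (hΔ : IsLowerSet Δ) {i : ℕ}
    (h : ∀ (G : Finset V) (n : ℕ), n + G.card = i → AcyclicAt L (del Δ G) n)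
    {c : Finset V → MvPolynomial V L}
    (hc : ∀ F : Finset V, F.card = i + 1 →
      koszulD (R := MvPolynomial V L) MvPolynomial.X c F ∈ faceIdeal L Δ)
    (a : V →₀ ℕ) : ∃ b : Finset V → L, (∀ F, ¬ Fᶜ ⊆ a.support → b F = 0) ∧
      ∀ F : Finset V, F.card = i → Fᶜ ⊆ a.support → (a - ind Fᶜ).support ∈ Δ →
        koszulD (1 : V → L) b F = component a c F := by
  have hc' : ∀ F : Finset V, F.card = i + 1 → Fᶜ ⊆ a.support → (a - ind Fᶜ).support ∈ Δ →
      koszulD (1 : V → L) (component a c) F = 0 := by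
    intro F hF hFa hm
    rw [← component_koszulD]
    exact (mem_faceIdeal_iff_component hΔ _ F).mp (hc F hF) a hFa hm
  by_cases hP : ∃ p, 2 ≤ a p
  · obtain ⟨p, hp⟩ := hP
    have hpa : p ∈ a.support := Finsupp.mem_support_iff.mpr (by omega)
    have hins : ∀ F : Finset V, (insert p F)ᶜ ⊆ a.support ↔ Fᶜ ⊆ a.support := by
      refine fun F => ⟨fun h' w hw => ?_, fun h' w hw => h' ?_⟩
      · by_cases hwp : w = p
        · exact hwp ▸ hpa
        · exact h' (by simpa [hwp] using hw)
      · rw [Finset.mem_compl] at hw ⊢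
        exact fun hw' => hw (Finset.mem_insert_of_mem hw')
    -- Since `a p ≥ 2`, the exponent at `p` stays positive whether or not `p ∈ F`. Inserting `p`
    -- therefore preserves the face condition, and contraction with `p` is a homotopy.
    refine ⟨contract L p (component a c), fun F hF => ?_, fun F hF hFa hm => ?_⟩
    · by_cases hpF : p ∈ F
      · exact contract_of_mem hpF _
      · rw [contract_of_notMem hpF, component_of_not_subset (mt (hins F).mp hF), smul_zero]
    · have e := contract_koszulD (1 : V → L) p (component a c) F
      rw [Pi.one_apply, one_smul] at e
      rw [← e, right_eq_add]
      by_cases hpF : p ∈ F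
      · exact contract_of_mem hpF _
      · rw [contract_of_notMem hpF, hc', smul_zero]
        · rw [Finset.card_insert_of_notMem hpF, hF]
        · exact (hins F).mpr hFa
        · convert hm using 1
          ext v
          by_cases hvp : v = p
          · subst hvp
            simp [ind_apply, hpF]
            omega
          · simp [ind_apply, hvp]
  · push Not at hP
    have h1 : ∀ v, a v ≤ 1 := fun v => Nat.le_of_lt_succ (hP v)
    -- Only sets `F = E ∪ G` with `E` disjoint from `G` contribute, and the monomial attached to
    -- such a set has support `E`.
    set G := a.supportᶜ with hG
    have hsub : ∀ F : Finset V, Fᶜ ⊆ a.support ↔ G ⊆ F := fun F => by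
      rw [hG]
      exact compl_le_iff_compl_le
    rcases lt_or_ge i G.card with hi | hi
    · refine ⟨0, fun _ _ => rfl, fun F hF hFa _ => ?_⟩
      have := Finset.card_le_card ((hsub F).mp hFa)
      omega
    · obtain ⟨n, hn⟩ := Nat.exists_eq_add_of_le' hi
      have hsupp : ∀ F : Finset V, Disjoint G F → (a - ind (F ∪ G)ᶜ).support = F := by
        intro F hF
        rw [support_sub_ind_of_le_one h1, ← hG, Finset.union_sdiff_cancel_right hF.symm]
      have hcomp : ∀ F, ¬ G ⊆ F → component a c F = 0 := fun F hF =>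
        component_of_not_subset (mt (hsub F).mp hF) _
      obtain ⟨b, hb⟩ := h G n hn.symm (shiftDown G (component a c)) fun F hF hFn => by
        rw [koszulD_shiftDown hcomp hF.1.symm, hc', mul_zero]
        · rw [Finset.card_union_of_disjoint hF.1.symm]
          omega
        · exact (hsub _).mpr Finset.subset_union_right
        · rw [hsupp F hF.1]
          exact hF.2
      refine ⟨shiftUp G b, fun F hF => shiftUp_of_not_subset (mt (hsub F).mpr hF) b,
        fun F hF hFa hm => ?_⟩
      have hGF := (hsub F).mp hFa
      obtain ⟨E, hE, rfl⟩ : ∃ E, Disjoint G E ∧ F = E ∪ G :=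
        ⟨F \ G, Finset.disjoint_sdiff, (Finset.sdiff_union_of_subset hGF).symm⟩
      rw [hsupp E hE] at hm
      rw [Finset.card_union_of_disjoint hE.symm] at hF
      rw [koszulD_shiftUp b hE.symm, hb E ⟨hE, hm⟩ (by omega), shiftDown, ← mul_assoc,
        twist_mul_self, one_mul]

theorem koszulVanishes_of_acyclicAt (hΔ : IsLowerSet Δ) {i : ℕ}
    (h : ∀ (G : Finset V) (n : ℕ), n + G.card = i → AcyclicAt L (del Δ G) n) :
    KoszulVanishes (faceIdeal L Δ) i := by
  classical
  intro c hc
  have H : ∀ a : V →₀ ℕ, ∃ b : Finset V → L, (component a c = 0 → b = 0) ∧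
      (∀ F, ¬ Fᶜ ⊆ a.support → b F = 0) ∧
      ∀ F : Finset V, F.card = i → Fᶜ ⊆ a.support → (a - ind Fᶜ).support ∈ Δ →
        koszulD (1 : V → L) b F = component a c F := by
    intro a
    by_cases ha : component a c = 0
    · exact ⟨0, fun _ => rfl, fun _ _ => rfl, fun F _ _ _ => by simp [ha]⟩
    · obtain ⟨b, hb, hb'⟩ := exists_primitive_component hΔ h hc a
      exact ⟨b, fun h' => absurd h' ha, hb, hb'⟩
  choose b hb0 hb1 hb2 using H
  -- The multidegrees that occur in `c`. Taking the zero primitive elsewhere keeps the sum in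
  -- `assemble` finite.
  let T : Finset (V →₀ ℕ) :=
    Finset.univ.biUnion fun F : Finset V => (c F).support.image (· + ind Fᶜ)
  have hT : ∀ a ∉ T, b a = 0 := by
    refine fun a ha => hb0 a (funext fun F => ?_)
    by_contra hne
    have hFa : Fᶜ ⊆ a.support := by
      by_contra h'
      exact hne (component_of_not_subset h' c)
    rw [component_of_subset hFa] at hne
    refine ha (Finset.mem_biUnion.mpr ⟨F, Finset.mem_univ _, Finset.mem_image.mpr
      ⟨a - ind Fᶜ, MvPolynomial.mem_support_iff.mpr hne, tsub_add_cancel_of_le fun v => ?_⟩⟩)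
    rw [ind_apply]
    split_ifs with hv
    · exact Nat.one_le_iff_ne_zero.mpr (Finsupp.mem_support_iff.mp (hFa hv))
    · exact Nat.zero_le _
  refine ⟨assemble T b, fun F hF => ?_⟩
  rw [mem_faceIdeal_iff_component hΔ]
  intro a hFa hm
  rw [component_sub, component_koszulD, component_assemble hT hb1, hb2 a F hF hFa hm, sub_self]

theorem acyclicAt_of_koszulVanishes (hΔ : IsLowerSet Δ) {G : Finset V} {n : ℕ}
    (h : KoszulVanishes (faceIdeal L Δ) (n + G.card)) : AcyclicAt L (del Δ G) n := by
  classical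
  intro c hc
  -- The squarefree multidegree with zero set `G`: its component sees exactly `del Δ G`.
  set a : V →₀ ℕ := ind Gᶜ with ha
  have h1 : ∀ v, a v ≤ 1 := fun v => by
    rw [ha, ind_apply]
    split_ifs <;> simp
  have hG : a.supportᶜ = G := by
    ext v
    simp [ha, ind_apply]
  have hsub : ∀ F : Finset V, Fᶜ ⊆ a.support ↔ G ⊆ F := fun F => by
    rw [← hG]
    exact compl_le_iff_compl_le
  have hsupp : ∀ F : Finset V, Disjoint G F → (a - ind (F ∪ G)ᶜ).support = F := by
    intro F hF
    rw [support_sub_ind_of_le_one h1, hG, Finset.union_sdiff_cancel_right hF.symm]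
  let β : (V →₀ ℕ) → Finset V → L := fun a' => if a' = a then shiftUp G c else 0
  have hβ : ∀ a', component a' (assemble {a} β) = β a' := by
    refine component_assemble (fun a' ha' => if_neg (by simpa using ha')) fun a' F hF => ?_
    by_cases e : a' = a
    · subst e
      simp only [β, if_true]
      exact shiftUp_of_not_subset (mt (hsub F).mpr hF) c
    · simp [β, e]
  obtain ⟨B, hB⟩ := h (assemble {a} β) fun F hF => by
    rw [mem_faceIdeal_iff_component hΔ]
    intro a' hFa hm
    rw [component_koszulD, hβ]
    by_cases e : a' = a
    · subst e
      obtain ⟨E, hE, rfl⟩ : ∃ E, Disjoint G E ∧ F = E ∪ G := ⟨F \ G, Finset.disjoint_sdiff,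
        (Finset.sdiff_union_of_subset ((hsub F).mp hFa)).symm⟩
      rw [hsupp E hE] at hm
      rw [Finset.card_union_of_disjoint hE.symm] at hF
      simp only [β, if_true]
      rw [koszulD_shiftUp c hE.symm, hc E ⟨hE, hm⟩ (by omega), mul_zero]
    · simp [β, e]
  refine ⟨shiftDown G (component a B), fun F hF hn => ?_⟩
  have hFG : (F ∪ G)ᶜ ⊆ a.support := (hsub _).mpr Finset.subset_union_right
  have key := (mem_faceIdeal_iff_component hΔ _ (F ∪ G)).mp
    (hB (F ∪ G) (by rw [Finset.card_union_of_disjoint hF.1.symm, hn])) a hFG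
    (by rw [hsupp F hF.1]; exact hF.2)
  rw [component_sub, component_koszulD, hβ, sub_eq_zero] at key
  simp only [β, if_true] at key
  rw [koszulD_shiftDown (fun E hE => component_of_not_subset (mt (hsub E).mp hE) B) hF.1.symm,
    ← key, shiftUp_union hF.1.symm, ← mul_assoc, twist_mul_self, one_mul]

end Hochster

/-! ### Regular sequences kill Koszul cohomology -/

section Depth

variable {V : Type*} [LinearOrder V] {R : Type*} [CommRing R] {N : Type*} [AddCommGroup N]
  [Module R N]

/-- Elements of the ideal generated by the family `x` annihilate its Koszul cohomology. -/
theorem exists_koszulD_eq_smul (x : V → R) (P : Submodule R N) {c : Finset V → N} {i : ℕ}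
    (hc : ∀ F : Finset V, F.card = i + 1 → koszulD x c F ∈ P) {r : R}
    (hr : r ∈ Ideal.span (Set.range x)) :
    ∃ b : Finset V → N, ∀ F : Finset V, F.card = i → (r • c - koszulD x b) F ∈ P := by
  induction hr using Submodule.span_induction with
  | mem r hr =>
    obtain ⟨v, rfl⟩ := hr
    refine ⟨contract R v c, fun F hF => ?_⟩
    rw [Pi.sub_apply, Pi.smul_apply, ← contract_koszulD, add_sub_cancel_right]
    by_cases hv : v ∈ F
    · rw [contract_of_mem hv]
      exact P.zero_mem
    · rw [contract_of_notMem hv]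
      exact P.smul_mem _ (hc _ (by rw [Finset.card_insert_of_notMem hv, hF]))
  | zero => exact ⟨0, fun F _ => by simp⟩
  | add r s _ _ hr hs =>
    obtain ⟨b, hb⟩ := hr
    obtain ⟨b', hb'⟩ := hs
    refine ⟨b + b', fun F hF => ?_⟩
    have := P.add_mem (hb F hF) (hb' F hF)
    rwa [← Pi.add_apply, sub_add_sub_comm, ← add_smul, ← map_add] at this
  | smul a r _ hr =>
    obtain ⟨b, hb⟩ := hr
    refine ⟨a • b, fun F hF => ?_⟩
    have := P.smul_mem a (hb F hF)
    rwa [← Pi.smul_apply, smul_sub, smul_smul, ← map_smul] at this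

/-- The Koszul cohomology of `x` with coefficients in `N` vanishes below the length of a weakly
regular sequence on `N` in the ideal generated by `x`. -/
theorem exists_koszulD_eq_of_isWeaklyRegular (x : V → R) (rs : List R) :
    ∀ {N : Type v} [AddCommGroup N] [Module R N],
      RingTheory.Sequence.IsWeaklyRegular N rs → (∀ r ∈ rs, r ∈ Ideal.span (Set.range x)) →
      ∀ i < rs.length, ∀ c : Finset V → N, (∀ F : Finset V, F.card = i + 1 → koszulD x c F = 0) →
        ∃ b : Finset V → N, ∀ F : Finset V, F.card = i → koszulD x b F = c F := by
  induction rs with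
  | nil => exact fun _ _ i hi => absurd hi (Nat.not_lt_zero i)
  | cons r rs ih =>
    intro N _ _ hreg hx i hi c hc
    obtain ⟨hr, hrs⟩ := (RingTheory.Sequence.isWeaklyRegular_cons_iff N r rs).mp hreg
    obtain ⟨b, hb⟩ := exists_koszulD_eq_smul x (⊥ : Submodule R N) (c := c) (i := i) (r := r)
      (fun F hF => (Submodule.mem_bot R).mpr (hc F hF)) (hx r List.mem_cons_self)
    have hb : ∀ F : Finset V, F.card = i → r • c F = koszulD x b F := fun F hF =>
      sub_eq_zero.mp ((Submodule.mem_bot R).mp (hb F hF))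
    cases i with
    | zero =>
      refine ⟨0, fun F hF => hr ?_⟩
      change r • koszulD x 0 F = r • c F
      rw [hb F hF, Finset.card_eq_zero.mp hF]
      simp [koszulD_apply]
    | succ j =>
      -- From `r c = d b`, the cochain `b` is a cocycle modulo `r`. By induction `b = d l + r f`, so
      -- `r (d f) = r c`, and `r` can be cancelled.
      let π : N →ₗ[R] QuotSMulTop r N := Submodule.mkQ _
      obtain ⟨e, he⟩ := ih hrs (fun s hs => hx s (List.mem_cons_of_mem _ hs)) j
        (by simpa using hi) (fun F => π (b F)) fun F hF => by
          rw [koszulD_map, ← hb F hF]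
          exact (Submodule.Quotient.mk_eq_zero _).mpr
            (Submodule.smul_mem_pointwise_smul _ _ _ trivial)
      choose l hl using fun F => Submodule.mkQ_surjective _ (e F)
      have hf : ∀ F : Finset V, ∃ f : N, F.card = j → b F - koszulD x l F = r • f := by
        intro F
        by_cases hF : F.card = j
        · have : π (b F - koszulD x l F) = 0 := by
            rw [map_sub, ← koszulD_map, ← he F hF, sub_eq_zero]
            exact koszulD_congr _ fun v _ => (hl _).symm
          obtain ⟨f, -, hf⟩ := (Submodule.mem_smul_pointwise_iff_exists _ _ _).mp
            ((Submodule.Quotient.mk_eq_zero _).mp this)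
          exact ⟨f, fun _ => hf.symm⟩
        · exact ⟨0, fun h => absurd h hF⟩
      choose f hf using hf
      refine ⟨f, fun F hF => hr ?_⟩
      change r • koszulD x f F = r • c F
      have h1 : koszulD x (r • f) F = koszulD x (b - koszulD x l) F :=
        koszulD_congr _ fun v hv => (hf _ (by rw [Finset.card_erase_of_mem hv, hF]; rfl)).symm
      rw [hb F hF, ← Pi.smul_apply, ← map_smul, h1, map_sub, Pi.sub_apply, koszulD_koszulD,
        sub_zero]

end Depth

/-! ### Regular sequences at a prime, written with denominators -/

section LocRegular

variable {B : Type*} [CommRing B]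

/-- The sequence `rs` is weakly regular on the localization of `B ⧸ I` at the prime `M`. -/
def LocRegular (M : Ideal B) : Ideal B → List B → Prop
  | _, [] => True
  | I, r :: rs => (∀ g, r * g ∈ I → ∃ s ∉ M, s * g ∈ I) ∧ LocRegular M (I ⊔ Ideal.span {r}) rs

theorem exists_notMem_forall_mul_mem (M : Ideal B) [M.IsPrime] {ι : Type*} [Finite ι] (I : Ideal B)
    (g : ι → B) (p : ι → Prop) (h : ∀ i, p i → ∃ s ∉ M, s * g i ∈ I) :
    ∃ s ∉ M, ∀ i, p i → s * g i ∈ I := by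
  classical
  cases nonempty_fintype ι
  have : ∀ i, ∃ s ∉ M, p i → s * g i ∈ I := fun i => by
    by_cases hi : p i
    · obtain ⟨s, hs, hg⟩ := h i hi
      exact ⟨s, hs, fun _ => hg⟩
    · exact ⟨1, (Ideal.ne_top_iff_one M).mp (Ideal.IsPrime.ne_top inferInstance),
        fun h => absurd h hi⟩
  choose s hs hg using this
  refine ⟨∏ i, s i, fun hm => ?_, fun i hi => ?_⟩
  · obtain ⟨i, -, hi⟩ := (Ideal.IsPrime.prod_mem_iff).mp hm
    exact hs i hi
  · rw [← Finset.mul_prod_erase _ _ (Finset.mem_univ i), mul_right_comm]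
    exact I.mul_mem_right _ (hg i hi)

/-- Prime avoidance: the hypothesis keeps `J` out of each associated prime of `B ⧸ I` inside `M`,
and an element outside their union is a nonzerodivisor after localizing at `M`. -/
theorem exists_locRegular_element [IsNoetherianRing B] (M I J : Ideal B) [M.IsPrime]
    (h : ∀ g, (∀ x ∈ J, x * g ∈ I) → ∃ s ∉ M, s * g ∈ I) :
    ∃ r ∈ J, ∀ g, r * g ∈ I → ∃ s ∉ M, s * g ∈ I := by
  have hcolon : ∀ g r : B, r ∈ Submodule.colon I {g} ↔ r * g ∈ I := fun g r => by
    rw [Submodule.mem_colon_singleton, smul_eq_mul]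
  have hcolon' : ∀ g : B, Submodule.colon (⊥ : Submodule B (B ⧸ I)) {Ideal.Quotient.mk I g} =
      Submodule.colon I {g} := fun g => by
    ext r
    rw [Submodule.mem_colon_singleton, hcolon, Submodule.mem_bot, ← Ideal.Quotient.eq_zero_iff_mem,
      map_mul]
    rfl
  let T := {p ∈ associatedPrimes B (B ⧸ I) | p ≤ M}
  have hT : T.Finite := (associatedPrimes.finite B (B ⧸ I)).subset fun _ hp => hp.1
  have hJ : ¬ ((J : Set B) ⊆ ⋃ p ∈ T, (p : Set B)) := by
    intro hsub
    obtain ⟨p, ⟨hp, hpM⟩, hJp⟩ := (Ideal.subset_union_prime_finite hT ⊥ ⊥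
      fun p hp _ _ => hp.1.isPrime).mp hsub
    obtain ⟨-, y, hy⟩ := isAssociatedPrime_iff.mp hp
    obtain ⟨g, rfl⟩ := Ideal.Quotient.mk_surjective y
    rw [hcolon'] at hy
    obtain ⟨s, hs, hsg⟩ := h g fun x hx => (hcolon g x).mp (hy ▸ hJp hx)
    exact hs (hpM (hy ▸ (hcolon g s).mpr hsg))
  obtain ⟨r, hrJ, hr⟩ := Set.not_subset.mp hJ
  refine ⟨r, hrJ, fun g hg => ?_⟩
  by_contra hno
  push Not at hno
  have hle : Submodule.colon I {g} ≤ M := fun s hs => by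
    by_contra hsM
    exact hno s hsM ((hcolon g s).mp hs)
  obtain ⟨p, hp, hpM⟩ := Ideal.exists_minimalPrimes_le hle
  obtain ⟨y, hy⟩ := Submodule.exists_eq_colon_of_mem_minimalPrimes hp
  refine hr (Set.mem_biUnion (x := p) ⟨isAssociatedPrime_iff.mpr ⟨hp.isPrime,
    Ideal.Quotient.mk I y, by rw [hcolon', ← hy]⟩, hpM⟩ ?_)
  exact hp.1.2 ((hcolon g r).mpr hg)

variable {V : Type*} [LinearOrder V] [Finite V]

/-- The Koszul cohomology of `x` on the localization of `B ⧸ I` at `M` vanishes in degree `i`. -/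
def LocKoszulVanishes (M : Ideal B) (x : V → B) (I : Ideal B) (i : ℕ) : Prop :=
  ∀ c : Finset V → B, (∀ F : Finset V, F.card = i + 1 → koszulD x c F ∈ I) →
    ∃ s ∉ M, ∃ b : Finset V → B, ∀ F : Finset V, F.card = i → (s • c - koszulD x b) F ∈ I

/-- The long exact sequence for multiplication by `r` on `B ⧸ I`: degree `i` of the quotient by `r`
sits between degrees `i` and `i + 1` of `B ⧸ I`. -/
theorem LocKoszulVanishes.sup_span_singleton {M : Ideal B} [M.IsPrime] {x : V → B} {I : Ideal B}
    {i : ℕ} (h : LocKoszulVanishes M x I i) (h' : LocKoszulVanishes M x I (i + 1)) {r : B}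
    (hr : ∀ g, r * g ∈ I → ∃ s ∉ M, s * g ∈ I) :
    LocKoszulVanishes M x (I ⊔ Ideal.span {r}) i := by
  intro c hc
  have he : ∀ F : Finset V, ∃ e, F.card = i + 1 → koszulD x c F - r * e ∈ I := by
    intro F
    by_cases hF : F.card = i + 1
    · obtain ⟨y, hy, z, hz, hyz⟩ := Submodule.mem_sup.mp (hc F hF)
      obtain ⟨e, rfl⟩ := Ideal.mem_span_singleton'.mp hz
      exact ⟨e, fun _ => by rwa [← hyz, mul_comm r, add_sub_cancel_right]⟩
    · exact ⟨0, fun h => absurd h hF⟩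
  choose e he using he
  have hcard : ∀ {n : ℕ} {F : Finset V} {v : V}, v ∈ F → F.card = n + 1 → (F.erase v).card = n :=
    fun hv hF => by rw [Finset.card_erase_of_mem hv, hF]; rfl
  obtain ⟨s, hs, hse⟩ := exists_notMem_forall_mul_mem M I (koszulD x e)
    (fun F : Finset V => F.card = i + 1 + 1) fun F hF => hr _ (by
      have := koszulD_mem x I (c := koszulD x c - r • e) (F := F)
        fun v hv => he _ (hcard hv hF)
      rw [map_sub, map_smul, Pi.sub_apply, koszulD_koszulD, zero_sub] at this
      exact neg_mem_iff.mp this)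
  obtain ⟨s', hs', f, hf⟩ := h' (s • e) fun F hF => by
    rw [map_smul]
    exact hse F hF
  obtain ⟨s'', hs'', g, hg⟩ := h ((s' * s) • c - r • f) fun F hF => by
    have h1 := I.mul_mem_left (s' * s) (he F hF)
    have h2 := I.mul_mem_left r (hf F hF)
    have := I.add_mem h1 h2
    rw [map_sub, map_smul, map_smul]
    simp only [Pi.sub_apply, Pi.smul_apply, smul_eq_mul] at this ⊢
    convert this using 1
    ring
  refine ⟨s'' * (s' * s), fun hm => ?_, g, fun F hF => ?_⟩
  · rcases Ideal.IsPrime.mem_or_mem inferInstance hm with hm | hm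
    · exact hs'' hm
    · rcases Ideal.IsPrime.mem_or_mem inferInstance hm with hm | hm
      · exact hs' hm
      · exact hs hm
  · have h1 := Submodule.mem_sup_left (T := Ideal.span {r}) (hg F hF)
    have h2 : s'' * (r * f F) ∈ I ⊔ Ideal.span {r} := Submodule.mem_sup_right
      (Ideal.mul_mem_left _ _ (Ideal.mul_mem_right _ _ (Ideal.mem_span_singleton_self r)))
    have := Ideal.add_mem _ h1 h2
    simp only [Pi.sub_apply, Pi.smul_apply, smul_eq_mul] at this ⊢
    convert this using 1
    ring

/-- Vanishing in degree 0 says that no nonzero element of the localization is killed by all `x v`,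
which yields a regular element. Passing to the quotient costs one degree of vanishing. -/
theorem exists_locRegular_of_locKoszulVanishes [IsNoetherianRing B] (M : Ideal B) [M.IsPrime]
    (x : V → B) (n : ℕ) : ∀ I : Ideal B, (∀ i < n, LocKoszulVanishes M x I i) →
      ∃ rs : List B, rs.length = n ∧ (∀ r ∈ rs, r ∈ Ideal.span (Set.range x)) ∧
        LocRegular M I rs := by
  induction n with
  | zero => exact fun I _ => ⟨[], rfl, by simp, trivial⟩
  | succ n ih =>
    intro I h
    obtain ⟨r, hrx, hr⟩ := exists_locRegular_element M I (Ideal.span (Set.range x)) fun g hg => by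
      obtain ⟨s, hs, b, hb⟩ := h 0 (Nat.succ_pos n) (fun _ => g) fun F hF => by
        obtain ⟨v, rfl⟩ := Finset.card_eq_one.mp hF
        simpa [koszulD_apply, Finset.filter_singleton] using
          hg (x v) (Ideal.subset_span ⟨v, rfl⟩)
      exact ⟨s, hs, by simpa [koszulD_apply] using hb ∅ rfl⟩
    obtain ⟨rs, hlen, hrs, hreg⟩ := ih (I ⊔ Ideal.span {r}) fun i hi =>
      (h i (by omega)).sup_span_singleton (h (i + 1) (by omega)) hr
    refine ⟨r :: rs, by simp [hlen], ?_, hr, hreg⟩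
    intro r' hr'
    rcases List.mem_cons.mp hr' with rfl | hr'
    · exact hrx
    · exact hrs r' hr'

end LocRegular

/-! ### Transport of regular sequences and passage to the localization -/

section LocRegular

variable {B B' : Type*} [CommRing B] [CommRing B']

/-- The two ideals have the same localization at `M`, and regularity there depends only on it. -/
theorem LocRegular.of_le {M : Ideal B} [M.IsPrime] {rs : List B} : ∀ {I K : Ideal B}, I ≤ K →
    (∀ g ∈ K, ∃ s ∉ M, s * g ∈ I) → LocRegular M K rs → LocRegular M I rs := by
  induction rs with
  | nil => exact fun _ _ _ => trivial
  | cons r rs ih =>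
    rintro I K hIK h ⟨hr, hrs⟩
    refine ⟨fun g hg => ?_, ih (sup_le_sup_right hIK _) (fun g hg => ?_) hrs⟩
    · obtain ⟨s, hs, hsg⟩ := hr g (hIK hg)
      obtain ⟨s', hs', hsg'⟩ := h _ hsg
      exact ⟨s' * s, Ideal.IsPrime.mul_notMem inferInstance hs' hs, by rwa [mul_assoc]⟩
    · obtain ⟨y, hy, z, hz, rfl⟩ := Submodule.mem_sup.mp hg
      obtain ⟨s, hs, hsy⟩ := h y hy
      exact ⟨s, hs, by rw [mul_add]; exact Submodule.add_mem_sup hsy (Ideal.mul_mem_left _ _ hz)⟩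

/-- Lifting of locally regular sequences along a ring homomorphism which is surjective modulo an
ideal. -/
theorem LocRegular.exists_comap (φ : B →+* B') (M : Ideal B') [M.IsPrime] {rs : List B'} :
    ∀ {I : Ideal B'}, I ≤ M → (∀ y, ∃ x, y - φ x ∈ I) → (∀ r ∈ rs, r ∈ M) → LocRegular M I rs →
      ∃ rs' : List B, rs'.length = rs.length ∧ (∀ r ∈ rs', r ∈ M.comap φ) ∧
        LocRegular (M.comap φ) (I.comap φ) rs' := by
  induction rs with
  | nil => exact fun _ _ _ _ => ⟨[], rfl, by simp, trivial⟩
  | cons y rs ih =>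
    rintro I hIM hsurj hM ⟨hy, hrs⟩
    have hyM := hM y List.mem_cons_self
    obtain ⟨x, hx⟩ := hsurj y
    have hle : I ⊔ Ideal.span {y} ≤ M :=
      sup_le hIM ((Ideal.span_singleton_le_iff_mem M).mpr hyM)
    obtain ⟨rs', hlen, hmem, hreg⟩ := ih hle
      (fun z => (hsurj z).imp fun w hw => Submodule.mem_sup_left hw)
      (fun r hr => hM r (List.mem_cons_of_mem _ hr)) hrs
    have hcomap : (I ⊔ Ideal.span {y}).comap φ = I.comap φ ⊔ Ideal.span {x} := by
      refine le_antisymm (fun g hg => ?_) (sup_le (Ideal.comap_mono le_sup_left) ?_)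
      · obtain ⟨a, ha, b, hb, hab⟩ := Submodule.mem_sup.mp (Ideal.mem_comap.mp hg)
        obtain ⟨c, rfl⟩ := Ideal.mem_span_singleton'.mp hb
        obtain ⟨w, hw⟩ := hsurj c
        rw [← sub_add_cancel g (w * x)]
        refine Submodule.add_mem_sup ?_ (Ideal.mul_mem_left _ _ (Ideal.mem_span_singleton_self x))
        rw [Ideal.mem_comap, map_sub, map_mul, ← hab]
        have := I.add_mem ha (I.add_mem (I.mul_mem_left y hw) (I.mul_mem_left (φ w) hx))
        convert this using 1
        ring
      · rw [Ideal.span_singleton_le_iff_mem, Ideal.mem_comap, ← sub_sub_cancel y (φ x)]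
        exact Ideal.sub_mem _ (Submodule.mem_sup_right (Ideal.mem_span_singleton_self y))
          (Submodule.mem_sup_left hx)
    refine ⟨x :: rs', by simp [hlen], ?_, fun g hg => ?_, hcomap ▸ hreg⟩
    · intro r hr
      rcases List.mem_cons.mp hr with rfl | hr
      · rw [Ideal.mem_comap, ← sub_sub_cancel y (φ r)]
        exact M.sub_mem hyM (hIM hx)
      · exact hmem r hr
    · rw [Ideal.mem_comap, map_mul] at hg
      obtain ⟨s, hs, hsg⟩ := hy (φ g) (by
        have := I.add_mem hg (I.mul_mem_right (φ g) hx)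
        convert this using 1
        ring)
      obtain ⟨w, hw⟩ := hsurj s
      refine ⟨w, fun hwM => hs ?_, ?_⟩
      · rw [← sub_add_cancel s (φ w)]
        exact M.add_mem (hIM hw) hwM
      · rw [Ideal.mem_comap, map_mul]
        have := I.sub_mem hsg (I.mul_mem_right (φ g) hw)
        convert this using 1
        ring

theorem LocRegular.getElem {M : Ideal B} {rs : List B} : ∀ {I : Ideal B}, LocRegular M I rs →
    ∀ (i : ℕ) (hi : i < rs.length) (g : B), rs[i] * g ∈ I ⊔ Ideal.ofList (rs.take i) →
      ∃ s ∉ M, s * g ∈ I ⊔ Ideal.ofList (rs.take i) := by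
  induction rs with
  | nil => exact fun _ i hi => absurd hi (Nat.not_lt_zero i)
  | cons r rs ih =>
    rintro I ⟨hr, hrs⟩ i hi g hg
    cases i with
    | zero => simpa using hr g (by simpa using hg)
    | succ i =>
      rw [List.take_succ_cons, Ideal.ofList_cons, ← sup_assoc] at hg ⊢
      exact ih hrs i (by simpa using hi) g hg

theorem LocRegular.isWeaklyRegular {I : Ideal B} {M : Ideal (B ⧸ I)} [M.IsPrime] {rs : List B}
    (h : LocRegular (M.comap (Ideal.Quotient.mk I)) I rs) :
    RingTheory.Sequence.IsWeaklyRegular (Localization.AtPrime M)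
      (rs.map ((algebraMap (B ⧸ I) (Localization.AtPrime M)).comp (Ideal.Quotient.mk I))) := by
  set f := (algebraMap (B ⧸ I) (Localization.AtPrime M)).comp (Ideal.Quotient.mk I) with hf
  refine ⟨fun i hi => ?_⟩
  rw [List.length_map] at hi
  set J := Ideal.ofList (rs.take i) with hJ
  have hJ' : Ideal.ofList ((rs.map f).take i) • (⊤ : Submodule (Localization.AtPrime M) _) =
      J.map f := by
    rw [smul_eq_mul, Ideal.mul_top, ← List.map_take, ← Ideal.map_ofList]
  have hmem : ∀ b : B, f b ∈ J.map f ↔ ∃ s ∉ M.comap (Ideal.Quotient.mk I), s * b ∈ I ⊔ J := by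
    intro b
    rw [hf, ← Ideal.map_map, RingHom.comp_apply,
      IsLocalization.algebraMap_mem_map_algebraMap_iff M.primeCompl]
    constructor
    · rintro ⟨s, hs, hsb⟩
      obtain ⟨s, rfl⟩ := Ideal.Quotient.mk_surjective s
      refine ⟨s, hs, ?_⟩
      rw [← map_mul, ← Ideal.mem_comap, Ideal.comap_map_of_surjective' _
        Ideal.Quotient.mk_surjective, Ideal.mk_ker, sup_comm] at hsb
      exact hsb
    · rintro ⟨s, hs, hsb⟩
      refine ⟨Ideal.Quotient.mk I s, hs, ?_⟩
      rw [← map_mul, ← Ideal.mem_comap, Ideal.comap_map_of_surjective' _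
        Ideal.Quotient.mk_surjective, Ideal.mk_ker, sup_comm]
      exact hsb
  rw [hJ', List.getElem_map, isSMulRegular_iff_right_eq_zero_of_smul]
  intro x hx
  obtain ⟨x, rfl⟩ := Ideal.Quotient.mk_surjective x
  obtain ⟨⟨b, s⟩, hbs⟩ := IsLocalization.surj M.primeCompl x
  obtain ⟨b, rfl⟩ := Ideal.Quotient.mk_surjective b
  change x * algebraMap (B ⧸ I) (Localization.AtPrime M) s = f b at hbs
  have hu : IsUnit (algebraMap (B ⧸ I) (Localization.AtPrime M) s) :=
    IsLocalization.map_units (Localization.AtPrime M) s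
  have h1 : f rs[i] * x ∈ J.map f := Ideal.Quotient.eq_zero_iff_mem.mp hx
  have h2 : f (rs[i] * b) ∈ J.map f := by
    rw [map_mul, ← hbs, ← mul_assoc]
    exact Ideal.mul_mem_right _ _ h1
  obtain ⟨t, ht, htb⟩ := (hmem _).mp h2
  obtain ⟨t', ht', htb'⟩ := h.getElem i hi (t * b) (by rwa [mul_left_comm])
  have h3 : f b ∈ J.map f := (hmem b).mpr ⟨t' * t,
    Ideal.IsPrime.mul_notMem inferInstance ht' ht, by rwa [mul_assoc]⟩
  rw [← hbs] at h3
  exact Ideal.Quotient.eq_zero_iff_mem.mpr ((Ideal.mul_unit_mem_iff_mem _ hu).mp h3)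

end LocRegular

/-! ### Inverting a variable: from the face ring to the link -/

section Substitution

set_option linter.unusedSectionVars false

open MvPolynomial

variable {V : Type*} [LinearOrder V] {L S : Type*} [CommRing L] [CommRing S]
  [Algebra L S] {Δ : Set (Finset V)}

/-- Extension of the coefficients from `L` to `S` and substitution of `t` for the variable `v`. -/
noncomputable def substVar (v : V) (t : S) : MvPolynomial V L →+* MvPolynomial V S :=
  eval₂Hom (C.comp (algebraMap L S)) fun w => if w = v then C t else X w

theorem substVar_C (v : V) (t : S) (a : L) : substVar v t (C a) = C (algebraMap L S a) := by
  simp [substVar]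

theorem substVar_X_self (v : V) (t : S) : substVar (L := L) v t (X v) = C t := by
  simp [substVar]

theorem substVar_X_of_ne {v w : V} (h : w ≠ v) (t : S) :
    substVar (L := L) v t (X w) = X w := by
  simp [substVar, h]

theorem substVar_aeval_X_self (v : V) (t : S) (f : Polynomial L) :
    substVar v t (Polynomial.aeval (X v : MvPolynomial V L) f) = C (Polynomial.aeval t f) := by
  rw [Polynomial.aeval_def, Polynomial.hom_eval₂, substVar_X_self, Polynomial.aeval_def,
    Polynomial.hom_eval₂]
  congr 1
  ext a
  simp [substVar, algebraMap_eq]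

theorem substVar_aeval_X_of_ne {v w : V} (h : w ≠ v) (t : S) (f : Polynomial L) :
    substVar v t (Polynomial.aeval (X w : MvPolynomial V L) f) =
      Polynomial.aeval (X w : MvPolynomial V S) (f.map (algebraMap L S)) := by
  rw [Polynomial.aeval_def, Polynomial.hom_eval₂, substVar_X_of_ne h, Polynomial.aeval_def,
    Polynomial.eval₂_map]
  congr 1
  ext a
  simp [substVar, algebraMap_eq]

theorem prod_X_mem_faceIdeal {s : Finset V} (hs : s ∉ Δ) : ∏ i ∈ s, X i ∈ faceIdeal L Δ :=
  Ideal.subset_span ⟨s, hs, rfl⟩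

theorem X_mem_faceIdeal_lk (v : V) : X v ∈ faceIdeal L (lk Δ {v}) := by
  have := prod_X_mem_faceIdeal (L := L) (Δ := lk Δ {v}) (s := {v})
    (fun h => (mem_lk_singleton.mp h).1 (Finset.mem_singleton_self v))
  simpa using this

theorem substVar_mem_faceIdeal (hΔ : IsLowerSet Δ) (v : V) (t : S) :
    faceIdeal L Δ ≤ (faceIdeal S (lk Δ {v})).comap (substVar v t) := by
  refine Ideal.span_le.mpr ?_
  rintro _ ⟨s, hs, rfl⟩
  rw [SetLike.mem_coe, Ideal.mem_comap, map_prod]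
  have key : ∏ i ∈ s.erase v, substVar v t (X i : MvPolynomial V L) ∈
      faceIdeal S (lk Δ {v}) := by
    rw [Finset.prod_congr rfl fun i hi => substVar_X_of_ne (Finset.ne_of_mem_erase hi) t]
    refine prod_X_mem_faceIdeal fun h => hs (hΔ (Finset.insert_erase_subset v s) ?_)
    exact (mem_lk_singleton.mp h).2
  by_cases hv : v ∈ s
  · rw [← Finset.mul_prod_erase _ _ hv]
    exact Ideal.mul_mem_left _ _ key
  · rwa [Finset.erase_eq_of_notMem hv] at key

/-- Sending `t` to the class of `X v` and the variable `v` to 0 defines a map `ρ` that undoes the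
substitution modulo `I`. It carries nonfaces of the link to elements killed by `X v`. -/
theorem X_mul_mem_of_substVar_mem {v : V} {t : S} {I : Ideal (MvPolynomial V L)}
    (hI : faceIdeal L Δ ≤ I) (E : S →+* MvPolynomial V L ⧸ I)
    (hE : ∀ a, E (algebraMap L S a) = Ideal.Quotient.mk I (C a))
    (ht : E t = Ideal.Quotient.mk I (X v)) {g : MvPolynomial V L}
    (hg : substVar v t g ∈ faceIdeal S (lk Δ {v})) : X v * g ∈ I := by
  let ρ : MvPolynomial V S →+* MvPolynomial V L ⧸ I :=
    eval₂Hom E fun w => if w = v then 0 else Ideal.Quotient.mk I (X w)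
  have hρ : ρ.comp (substVar v t) = Ideal.Quotient.mk I := by
    refine MvPolynomial.ringHom_ext (fun a => ?_) fun w => ?_
    · simp [ρ, substVar_C, hE]
    · by_cases hw : w = v
      · subst hw
        simp [ρ, substVar_X_self, ht]
      · simp [ρ, substVar_X_of_ne hw, hw]
  have hann : ∀ p ∈ faceIdeal S (lk Δ {v}), Ideal.Quotient.mk I (X v) * ρ p = 0 := by
    intro p hp
    induction hp using Submodule.span_induction with
    | mem p hp =>
      obtain ⟨s, hs, rfl⟩ := hp
      by_cases hv : v ∈ s
      · rw [map_prod, Finset.prod_eq_zero hv (by simp [ρ]), mul_zero]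
      · have e : ∏ i ∈ s, ρ (X i) = Ideal.Quotient.mk I (∏ i ∈ s, X i) := by
          rw [map_prod]
          refine Finset.prod_congr rfl fun i hi => ?_
          have : i ≠ v := fun h => hv (h ▸ hi)
          simp [ρ, this]
        rw [map_prod, e, ← map_mul, Ideal.Quotient.eq_zero_iff_mem, ← Finset.prod_insert hv]
        exact hI (prod_X_mem_faceIdeal fun h => hs (mem_lk_singleton.mpr ⟨hv, h⟩))
    | zero => simp
    | add p q _ _ hp hq => rw [map_add, mul_add, hp, hq, add_zero]
    | smul a p _ hp => rw [smul_eq_mul, map_mul, mul_left_comm, hp, mul_zero]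
  have := hann _ hg
  rwa [← RingHom.comp_apply, hρ, ← map_mul, Ideal.Quotient.eq_zero_iff_mem] at this

/-- With `t` a free variable, `f (X v)` becomes the monic constant `f`, a nonzerodivisor. Thus `f (X
v)` is regular once `X v` is inverted. -/
theorem X_mul_mem_of_aeval_mul_mem (hΔ : IsLowerSet Δ) (v : V) {f : Polynomial L} (hf : f.Monic)
    {g : MvPolynomial V L} (hg : Polynomial.aeval (X v) f * g ∈ faceIdeal L Δ) :
    X v * g ∈ faceIdeal L Δ := by
  refine X_mul_mem_of_substVar_mem (S := Polynomial L) (t := Polynomial.X) le_rfl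
    (Polynomial.eval₂RingHom ((Ideal.Quotient.mk _).comp C) (Ideal.Quotient.mk _ (X v)))
    (fun a => by simp) (by simp) ?_
  have h := substVar_mem_faceIdeal hΔ v (Polynomial.X : Polynomial L) hg
  rw [Ideal.mem_comap, map_mul, substVar_aeval_X_self, Polynomial.aeval_X_left_apply,
    mem_faceIdeal_iff (isLowerSet_lk hΔ _)] at h
  rw [mem_faceIdeal_iff (isLowerSet_lk hΔ _)]
  intro m hm
  have := h m hm
  rw [coeff_C_mul] at this
  exact (hf.mul_right_eq_zero_iff).mp this

/-- Once `X v` is inverted, the kernel of the map to the face ring of the link over `L[T]/(f)` is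
generated by `f (X v)`. -/
theorem X_mul_mem_of_substVar_root_mem (v : V) (f : Polynomial L)
    {g : MvPolynomial V L}
    (hg : substVar v (AdjoinRoot.root f) g ∈ faceIdeal (AdjoinRoot f) (lk Δ {v})) :
    X v * g ∈ faceIdeal L Δ ⊔ Ideal.span {Polynomial.aeval (X v) f} := by
  set I := faceIdeal L Δ ⊔ Ideal.span {Polynomial.aeval (X v) f} with hI
  refine X_mul_mem_of_substVar_mem le_sup_left (AdjoinRoot.lift ((Ideal.Quotient.mk I).comp C)
    (Ideal.Quotient.mk I (X v)) ?_) (fun a => ?_) ?_ hg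
  · rw [← Polynomial.hom_eval₂]
    exact Ideal.Quotient.eq_zero_iff_mem.mpr
      (Submodule.mem_sup_right (Ideal.mem_span_singleton_self _))
  · rw [AdjoinRoot.algebraMap_eq, AdjoinRoot.lift_of, RingHom.comp_apply]
  · rw [AdjoinRoot.lift_root]

theorem exists_sub_substVar_root_mem (v : V) (f : Polynomial L)
    (y : MvPolynomial V (AdjoinRoot f)) : ∃ x : MvPolynomial V L,
      y - substVar v (AdjoinRoot.root f) x ∈ faceIdeal (AdjoinRoot f) (lk Δ {v}) := by
  induction y using MvPolynomial.induction_on with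
  | C a =>
    obtain ⟨p, rfl⟩ := AdjoinRoot.mk_surjective a
    refine ⟨Polynomial.aeval (X v) p, ?_⟩
    rw [substVar_aeval_X_self, AdjoinRoot.aeval_eq, sub_self]
    exact Ideal.zero_mem _
  | add p q hp hq =>
    obtain ⟨x, hx⟩ := hp
    obtain ⟨x', hx'⟩ := hq
    refine ⟨x + x', ?_⟩
    rw [map_add, ← sub_add_sub_comm]
    exact Ideal.add_mem _ hx hx'
  | mul_X p w hp =>
    by_cases hw : w = v
    · subst hw
      refine ⟨0, ?_⟩
      rw [map_zero, sub_zero]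
      exact Ideal.mul_mem_left _ _ (X_mem_faceIdeal_lk w)
    · obtain ⟨x, hx⟩ := hp
      refine ⟨x * X w, ?_⟩
      rw [map_mul, substVar_X_of_ne hw, ← sub_mul]
      exact Ideal.mul_mem_right _ _ hx

end Substitution

/-! ### Regular sequences of full length at every relevant prime -/

section Existence

open MvPolynomial

variable {V : Type*} [LinearOrder V] [Fintype V] {k : Type*} [Field k]

theorem exists_locRegular_faceIdeal_of_X_mem {d : ℕ} {L : Type*} [CommRing L] [Algebra k L]
    [IsNoetherianRing L] {Δ : Set (Finset V)} (hΔ : IsLowerSet Δ)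
    (H : ∀ (G : Finset V) (n : ℕ), n + G.card < d → AcyclicAt k (lk Δ G) n)
    (M : Ideal (MvPolynomial V L)) [M.IsPrime] (hX : ∀ v, X v ∈ M) :
    ∃ rs : List (MvPolynomial V L), rs.length = d ∧ (∀ r ∈ rs, r ∈ M) ∧
      LocRegular M (faceIdeal L Δ) rs := by
  obtain ⟨rs, hlen, hrs, hreg⟩ := exists_locRegular_of_locKoszulVanishes M
    (X : V → MvPolynomial V L) d (faceIdeal L Δ) fun i hi c hc => by
      obtain ⟨b, hb⟩ := koszulVanishes_of_acyclicAt (L := L) hΔ (i := i) (fun G n hn =>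
        ((acyclicAt_lk_iff_del hΔ d).mp H G n (hn ▸ hi)).baseChange) c hc
      exact ⟨1, (Ideal.ne_top_iff_one M).mp (Ideal.IsPrime.ne_top inferInstance), b,
        fun F hF => by rw [one_smul]; exact hb F hF⟩
  refine ⟨rs, hlen, fun r hr => Ideal.span_le.mpr ?_ (hrs r hr), hreg⟩
  rintro _ ⟨v, rfl⟩
  exact hX v

/-- Induction on `d` over all coefficient algebras `L` at once, since each step replaces Δ by a link
and `L` by `AdjoinRoot f`. Acyclicity stays over `k` until all variables lie in the prime; monic
polynomials replace residue field extensions. -/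
theorem exists_locRegular_faceIdeal (d : ℕ) : ∀ {L : Type v} [CommRing L] [Algebra k L]
    [IsNoetherianRing L] {Δ : Set (Finset V)}, IsLowerSet Δ →
    (∀ (G : Finset V) (n : ℕ), n + G.card < d → AcyclicAt k (lk Δ G) n) →
    ∀ (M : Ideal (MvPolynomial V L)) [M.IsPrime], faceIdeal L Δ ≤ M →
    (∀ v, ∃ f : Polynomial L, f.Monic ∧ Polynomial.aeval (X v) f ∈ M) →
    ∃ rs : List (MvPolynomial V L), rs.length = d ∧ (∀ r ∈ rs, r ∈ M) ∧
      LocRegular M (faceIdeal L Δ) rs := by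
  induction d with
  | zero => exact fun _ _ _ _ _ _ => ⟨[], rfl, by simp, trivial⟩
  | succ d ih =>
    intro L _ _ _ Δ hΔ H M _ hIM hint
    by_cases hX : ∀ v, X v ∈ M
    · exact exists_locRegular_faceIdeal_of_X_mem hΔ H M hX
    push Not at hX
    obtain ⟨v, hv⟩ := hX
    obtain ⟨f, hf, hfM⟩ := hint v
    set I := faceIdeal L Δ with hI
    set I' := faceIdeal (AdjoinRoot f) (lk Δ {v}) with hI'
    set φ : MvPolynomial V L →+* MvPolynomial V (AdjoinRoot f) :=
      substVar v (AdjoinRoot.root f) with hφ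
    have hfM' : I ⊔ Ideal.span {Polynomial.aeval (X v) f} ≤ M :=
      sup_le hIM ((Ideal.span_singleton_le_iff_mem M).mpr hfM)
    have hK : ∀ g ∈ I'.comap φ, X v * g ∈ I ⊔ Ideal.span {Polynomial.aeval (X v) f} :=
      fun g hg => X_mul_mem_of_substVar_root_mem v f hg
    have hKM : I'.comap φ ≤ M := fun g hg =>
      (Ideal.IsPrime.mem_or_mem inferInstance (hfM' (hK g hg))).resolve_left hv
    have hIK : I ⊔ Ideal.span {Polynomial.aeval (X v) f} ≤ I'.comap φ := by
      refine sup_le (substVar_mem_faceIdeal hΔ v _) ?_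
      rw [Ideal.span_singleton_le_iff_mem, Ideal.mem_comap, hφ, substVar_aeval_X_self,
        AdjoinRoot.aeval_eq, AdjoinRoot.mk_self, map_zero]
      exact Ideal.zero_mem _
    have hsurj : ∀ y, ∃ x, y - φ x ∈ I' := exists_sub_substVar_root_mem v f
    let π := (Ideal.Quotient.mk I').comp φ
    have hπ : Function.Surjective π := by
      intro y
      obtain ⟨y, rfl⟩ := Ideal.Quotient.mk_surjective y
      obtain ⟨x, hx⟩ := hsurj y
      exact ⟨x, (Ideal.Quotient.eq.mpr hx).symm⟩
    have hker : RingHom.ker π = I'.comap φ := by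
      ext g
      rw [RingHom.mem_ker, Ideal.mem_comap]
      exact Ideal.Quotient.eq_zero_iff_mem
    have hprime : (M.map π).IsPrime := Ideal.map_isPrime_of_surjective hπ (hker ▸ hKM)
    -- The prime over the new coefficients corresponding to `M`; it exists because `ker π` lies in
    -- `M`, as `X v ∉ M`.
    set M' := (M.map π).comap (Ideal.Quotient.mk I') with hM'
    have hM'M : M'.comap φ = M := by
      rw [hM', Ideal.comap_comap, Ideal.comap_map_of_surjective' π hπ, hker,
        sup_eq_left.mpr hKM]
    have hI'M' : I' ≤ M' := fun y hy => by
      rw [hM', Ideal.mem_comap, Ideal.Quotient.eq_zero_iff_mem.mpr hy]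
      exact Ideal.zero_mem _
    obtain ⟨rs', hlen', hrs', hreg'⟩ := ih (L := AdjoinRoot f) (isLowerSet_lk hΔ {v})
      (fun G n hn => by
        by_cases hvG : v ∈ G
        · rw [lk_eq_empty (isLowerSet_lk hΔ {v}) fun h => (mem_lk_singleton.mp h).1 hvG]
          exact acyclicAt_empty n
        · rw [lk_lk_singleton hvG]
          exact H _ _ (by rw [Finset.card_insert_of_notMem hvG]; omega))
      M' hI'M' (fun w => by
        by_cases hw : w = v
        · subst hw
          exact ⟨Polynomial.X, Polynomial.monic_X, by
            rw [Polynomial.aeval_X]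
            exact hI'M' (X_mem_faceIdeal_lk w)⟩
        · obtain ⟨p, hp, hpM⟩ := hint w
          refine ⟨p.map (algebraMap L (AdjoinRoot f)), hp.map _, ?_⟩
          rw [← substVar_aeval_X_of_ne hw (AdjoinRoot.root f), ← hφ, ← Ideal.mem_comap, hM'M]
          exact hpM)
    obtain ⟨rs, hlen, hrs, hreg⟩ := hreg'.exists_comap φ M' hI'M' hsurj hrs'
    rw [hM'M] at hrs hreg
    -- The lifted sequence is regular modulo `I'.comap φ`, which agrees with `I ⊔ (f (X v))` after
    -- inverting `X v`.
    refine ⟨Polynomial.aeval (X v) f :: rs, by simp [hlen, hlen'], ?_, ?_, ?_⟩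
    · intro r hr
      rcases List.mem_cons.mp hr with rfl | hr
      · exact hfM
      · exact hrs r hr
    · exact fun g hg => ⟨X v, hv, X_mul_mem_of_aeval_mul_mem hΔ v hf hg⟩
    · exact hreg.of_le hIK fun g hg => ⟨X v, hv, hK g hg⟩

end Existence

/-! ### Krull dimension of the face ring -/

section Dimension

set_option linter.unusedSectionVars false

open MvPolynomial

variable {V : Type*} [LinearOrder V] [Fintype V] {k : Type*} [Field k] {Δ : Set (Finset V)}

/-- The variables outside the least prime of the chain form a face `F`. Modulo that prime the ring
is a quotient of `k[X_v | v ∈ F]`, so the chain contracts to a strict chain there. -/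
theorem length_le_of_card_le {d : ℕ} (hd : ∀ F ∈ Δ, F.card ≤ d)
    (p : LTSeries (PrimeSpectrum (MvPolynomial V k ⧸ faceIdeal k Δ))) : p.length ≤ d := by
  classical
  set q := p.head.asIdeal with hq
  let F : Finset V := Finset.univ.filter fun v => Ideal.Quotient.mk (faceIdeal k Δ) (X v) ∉ q
  have hF : F ∈ Δ := by
    by_contra hF
    have h0 : ∏ v ∈ F, Ideal.Quotient.mk (faceIdeal k Δ) (X v) ∈ q := by
      rw [← map_prod, Ideal.Quotient.eq_zero_iff_mem.mpr (prod_X_mem_faceIdeal hF)]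
      exact q.zero_mem
    obtain ⟨v, hv, hvq⟩ := Ideal.IsPrime.prod_mem_iff.mp h0
    exact (Finset.mem_filter.mp hv).2 hvq
  let g : MvPolynomial F k →+* MvPolynomial V k ⧸ faceIdeal k Δ :=
    (Ideal.Quotient.mk (faceIdeal k Δ)).comp (rename ((↑) : F → V)).toRingHom
  have hg : ∀ x, ∃ y, x - g y ∈ q := by
    intro x
    obtain ⟨x, rfl⟩ := Ideal.Quotient.mk_surjective x
    induction x using MvPolynomial.induction_on with
    | C a => exact ⟨C a, by simp [g]⟩
    | add x x' hx hx' =>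
      obtain ⟨y, hy⟩ := hx
      obtain ⟨y', hy'⟩ := hx'
      refine ⟨y + y', ?_⟩
      rw [map_add, map_add, ← sub_add_sub_comm]
      exact q.add_mem hy hy'
    | mul_X x v hx =>
      by_cases hv : v ∈ F
      · obtain ⟨y, hy⟩ := hx
        refine ⟨y * X ⟨v, hv⟩, ?_⟩
        have e : g (X ⟨v, hv⟩) = Ideal.Quotient.mk _ (X v) := by simp [g]
        rw [map_mul, map_mul, e, ← sub_mul]
        exact q.mul_mem_right _ hy
      · refine ⟨0, ?_⟩
        rw [map_zero, sub_zero, map_mul]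
        refine q.mul_mem_left _ ?_
        by_contra h
        exact hv (Finset.mem_filter.mpr ⟨Finset.mem_univ v, h⟩)
  let p' : LTSeries (PrimeSpectrum (MvPolynomial F k)) :=
    { length := p.length
      toFun := fun i => (p i).comap g
      step := fun i => by
        have hlt : p i.castSucc < p i.succ := p.step i
        have hle : q ≤ (p i.castSucc).asIdeal := LTSeries.head_le p _
        have hle' : q ≤ (p i.succ).asIdeal := LTSeries.head_le p _
        refine lt_of_le_not_ge (Ideal.comap_mono hlt.le) fun hge => hlt.not_ge fun x hx => ?_
        obtain ⟨y, hy⟩ := hg x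
        rw [← sub_add_cancel x (g y)]
        refine Ideal.add_mem _ (hle hy) (hge ?_)
        change g y ∈ (p i.succ).asIdeal
        rw [← sub_sub_cancel x (g y)]
        exact Ideal.sub_mem _ hx (hle' hy) }
  have h1 := Order.LTSeries.length_le_krullDim p'
  have h2 : Order.krullDim (PrimeSpectrum (MvPolynomial F k)) = F.card := by
    have := MvPolynomial.ringKrullDim_of_isNoetherianRing (R := k) (ι := F)
    rw [ringKrullDim_eq_zero_of_field, zero_add] at this
    rw [← ringKrullDim, this]
    simp
  rw [h2] at h1
  have h3 : p.length ≤ F.card := by exact_mod_cast h1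
  exact h3.trans (hd F hF)

theorem ringKrullDim_le_of_card_le {d : ℕ} (hd : ∀ F ∈ Δ, F.card ≤ d) :
    ringKrullDim (MvPolynomial V k ⧸ faceIdeal k Δ) ≤ d :=
  iSup_le fun p => by exact_mod_cast length_le_of_card_le hd p

variable (k) in
/-- The projection of the face ring onto the polynomial ring on the vertices of a face. -/
noncomputable def faceProj {σ : Finset V} (hσ : σ ∈ Δ) (hΔ : IsLowerSet Δ) :
    MvPolynomial V k ⧸ faceIdeal k Δ →+* MvPolynomial V k :=
  Ideal.Quotient.lift _ (aeval fun v => if v ∈ σ then (X v : MvPolynomial V k) else 0).toRingHom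
    fun a ha => by
      refine RingHom.mem_ker.mp ((Ideal.span_le (I := RingHom.ker (aeval fun v => if v ∈ σ then
        (X v : MvPolynomial V k) else 0).toRingHom)).mpr ?_ ha)
      rintro _ ⟨s, hs, rfl⟩
      obtain ⟨v, hv, hvσ⟩ := Finset.not_subset.mp fun h : s ⊆ σ => hs (hΔ h hσ)
      rw [SetLike.mem_coe, RingHom.mem_ker, map_prod]
      exact Finset.prod_eq_zero hv (by simp [hvσ])

theorem faceProj_mk {σ : Finset V} (hσ : σ ∈ Δ) (hΔ : IsLowerSet Δ) (a : MvPolynomial V k) :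
    faceProj k hσ hΔ (Ideal.Quotient.mk _ a) =
      aeval (fun v => if v ∈ σ then (X v : MvPolynomial V k) else 0) a := by
  rfl

variable (k) in
/-- The augmentation of the face ring, which sends the variables to zero. -/
noncomputable def augmentation (hΔ : IsLowerSet Δ) (h : ∅ ∈ Δ) :
    MvPolynomial V k ⧸ faceIdeal k Δ →+* k :=
  constantCoeff.comp (faceProj k h hΔ)

theorem augmentation_mk (hΔ : IsLowerSet Δ) (h : ∅ ∈ Δ) (a : MvPolynomial V k) :
    augmentation k hΔ h (Ideal.Quotient.mk _ a) = constantCoeff a := by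
  rw [augmentation, RingHom.comp_apply, faceProj_mk]
  induction a using MvPolynomial.induction_on <;> simp_all

theorem augmentation_surjective (hΔ : IsLowerSet Δ) (h : ∅ ∈ Δ) :
    Function.Surjective (augmentation k hΔ h) := fun a =>
  ⟨Ideal.Quotient.mk _ (C a), by rw [augmentation_mk, constantCoeff_C]⟩

/-- Removing vertices of `D` one at a time gives a strictly increasing chain of kernels, each prime
because the projections land in a domain. -/
theorem le_height_ker_faceProj (hΔ : IsLowerSet Δ) {D : Finset V} (hD : D ∈ Δ) (n : ℕ) :
    ∀ (σ : Finset V) (hσ : σ ⊆ D), σ.card + n = D.card →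
      (n : ℕ∞) ≤ (RingHom.ker (faceProj k (hΔ hσ hD) hΔ)).height := by
  induction n with
  | zero => exact fun _ _ _ => bot_le
  | succ n ih =>
    intro σ hσ hn
    obtain ⟨v, hvD, hvσ⟩ := Finset.exists_mem_notMem_of_card_lt_card (by omega : σ.card < D.card)
    have hτ : insert v σ ⊆ D := Finset.insert_subset hvD hσ
    have h1 := ih (insert v σ) hτ (by rw [Finset.card_insert_of_notMem hvσ]; omega)
    have h2 : RingHom.ker (faceProj k (hΔ hτ hD) hΔ) < RingHom.ker (faceProj k (hΔ hσ hD) hΔ) := by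
      refine lt_of_le_of_ne (fun x hx => ?_) fun e => ?_
      · obtain ⟨x, rfl⟩ := Ideal.Quotient.mk_surjective x
        rw [RingHom.mem_ker, faceProj_mk] at hx ⊢
        have := congrArg (aeval fun v => if v ∈ σ then (X v : MvPolynomial V k) else 0) hx
        rw [map_zero, ← AlgHom.comp_apply] at this
        rw [← this]
        refine DFunLike.congr_fun (MvPolynomial.algHom_ext fun w => ?_) x
        by_cases hw : w ∈ σ <;> by_cases hwv : w = v <;> simp_all
      · have h3 : Ideal.Quotient.mk _ (X v) ∈ RingHom.ker (faceProj k (hΔ hσ hD) hΔ) := by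
          rw [RingHom.mem_ker, faceProj_mk]
          simp [hvσ]
        rw [← e, RingHom.mem_ker, faceProj_mk] at h3
        simp [X_ne_zero] at h3
    have hp1 : (RingHom.ker (faceProj k (hΔ hτ hD) hΔ)).IsPrime := RingHom.ker_isPrime _
    have hp2 : (RingHom.ker (faceProj k (hΔ hσ hD) hΔ)).IsPrime := RingHom.ker_isPrime _
    refine le_trans ?_ (Ideal.height_add_one_le_of_lt_of_isPrime h2)
    push_cast
    gcongr

theorem card_le_height_ker_augmentation (hΔ : IsLowerSet Δ) (h : ∅ ∈ Δ) {D : Finset V}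
    (hD : D ∈ Δ) : (D.card : ℕ∞) ≤ (RingHom.ker (augmentation k hΔ h)).height := by
  refine (le_height_ker_faceProj (k := k) hΔ hD D.card ∅ (Finset.empty_subset D)
    (by simp)).trans (Ideal.height_mono fun x hx => ?_)
  rw [RingHom.mem_ker, augmentation, RingHom.comp_apply, RingHom.mem_ker.mp hx, map_zero]

end Dimension

/-! ### Depth, localization at maximal ideals and the equivalence -/

section CohenMacaulay

set_option linter.unusedSectionVars false

open MvPolynomial

variable {V : Type*} [LinearOrder V] [Fintype V] {k : Type*} [Field k] {Δ : Set (Finset V)}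

theorem length_le_ringKrullDim {A : Type*} [CommRing A] [IsLocalRing A] [IsNoetherianRing A]
    {rs : List A} (h : RingTheory.Sequence.IsRegular A rs) :
    (rs.length : WithBot ℕ∞) ≤ ringKrullDim A := by
  rw [← ringKrullDim_add_length_eq_ringKrullDim_of_isRegular rs h]
  have hne : Ideal.ofList rs ≠ ⊤ := fun e => h.top_ne_smul (by simp [e])
  have : Nontrivial (A ⧸ Ideal.ofList rs) := Ideal.Quotient.nontrivial_iff.mpr hne
  exact le_add_of_nonneg_left ringKrullDim_nonneg_of_nontrivial

/-- By the Nullstellensatz the residue field is finite over `k`, so the class of each variable is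
integral. -/
theorem exists_monic_aeval_mem (I : Ideal (MvPolynomial V k)) (M : Ideal (MvPolynomial V k ⧸ I))
    [M.IsMaximal] (v : V) : ∃ f : Polynomial k, f.Monic ∧
      Polynomial.aeval (X v) f ∈ M.comap (Ideal.Quotient.mk I) := by
  let _ := Ideal.Quotient.field M
  have : Module.Finite k ((MvPolynomial V k ⧸ I) ⧸ M) :=
    finite_of_finite_type_of_isJacobsonRing k _
  let π : MvPolynomial V k →ₐ[k] (MvPolynomial V k ⧸ I) ⧸ M :=
    (Ideal.Quotient.mkₐ k M).comp (Ideal.Quotient.mkₐ k I)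
  obtain ⟨f, hf, h0⟩ := Algebra.IsIntegral.isIntegral (R := k) (π (X v))
  refine ⟨f, hf, ?_⟩
  rw [← Polynomial.aeval_def, Polynomial.aeval_algHom_apply] at h0
  rw [Ideal.mem_comap, ← Ideal.Quotient.eq_zero_iff_mem]
  exact h0

/-- A regular sequence of length `d` bounds depth and dimension below, and the size of faces bounds
the dimension above by the same `d`. -/
theorem isCohenMacaulay_of_acyclicAt (hΔ : IsLowerSet Δ) {d : ℕ} (hd : ∀ F ∈ Δ, F.card ≤ d)
    (H : ∀ (G : Finset V) (n : ℕ), n + G.card < d → AcyclicAt k (lk Δ G) n) :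
    IsCohenMacaulay (MvPolynomial V k ⧸ faceIdeal k Δ) where
  isNoetherianRing := inferInstance
  depth_eq_dim M _ := by
    have hM : M.IsPrime := Ideal.IsMaximal.isPrime inferInstance
    have hIM : faceIdeal k Δ ≤ M.comap (Ideal.Quotient.mk (faceIdeal k Δ)) := fun x hx => by
      rw [Ideal.mem_comap, Ideal.Quotient.eq_zero_iff_mem.mpr hx]
      exact M.zero_mem
    obtain ⟨rs, hlen, hrs, hreg⟩ := exists_locRegular_faceIdeal d hΔ H
      (M.comap (Ideal.Quotient.mk (faceIdeal k Δ))) hIM (exists_monic_aeval_mem _ M)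
    have hw := hreg.isWeaklyRegular
    set rs' := rs.map ((algebraMap _ (Localization.AtPrime M)).comp (Ideal.Quotient.mk (faceIdeal k Δ)))
      with hrs'
    have hmem : ∀ r ∈ rs', r ∈ IsLocalRing.maximalIdeal (Localization.AtPrime M) := by
      intro r hr
      obtain ⟨t, ht, rfl⟩ := List.mem_map.mp hr
      rw [← Localization.AtPrime.map_eq_maximalIdeal]
      exact Ideal.mem_map_of_mem _ (hrs t ht)
    have hreg' : RingTheory.Sequence.IsRegular (Localization.AtPrime M) rs' :=
      (IsLocalRing.isRegular_iff_isWeaklyRegular_of_subset_maximalIdeal hmem).mpr hw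
    have hlen' : rs'.length = d := by rw [hrs', List.length_map, hlen]
    have hle : ringKrullDim (Localization.AtPrime M) ≤ d := by
      rw [IsLocalization.AtPrime.ringKrullDim_eq_height M (Localization.AtPrime M)]
      exact Ideal.height_le_ringKrullDim_of_isPrime.trans (ringKrullDim_le_of_card_le hd)
    have hdim : ringKrullDim (Localization.AtPrime M) = d :=
      le_antisymm hle (hlen' ▸ length_le_ringKrullDim hreg')
    have hdepth : localDepth (Localization.AtPrime M) = d := by
      refine le_antisymm (iSup_le fun rs => ?_) ?_
      · have := (length_le_ringKrullDim rs.2.1).trans hle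
        exact_mod_cast this
      · rw [← hlen']
        exact le_iSup (fun rs : {rs : List (Localization.AtPrime M) //
          RingTheory.Sequence.IsRegular _ rs ∧ ∀ r ∈ rs, r ∈ IsLocalRing.maximalIdeal _} =>
            (rs.1.length : ℕ∞)) ⟨rs', hreg', hmem⟩
    rw [hdim, hdepth]
    rfl

theorem koszulD_ringHom {R S : Type*} [CommRing R] [CommRing S] (f : R →+* S) (x : V → R)
    (c : Finset V → R) (F : Finset V) :
    koszulD (fun v => f (x v)) (fun G => f (c G)) F = f (koszulD x c F) := by
  simp [koszulD_apply]

theorem mem_span_range_X {p : MvPolynomial V k} (hp : constantCoeff p = 0) :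
    p ∈ Ideal.span (Set.range (X : V → MvPolynomial V k)) := by
  rw [← Set.image_univ, mem_ideal_span_X_image]
  intro m hm
  by_contra! h
  obtain rfl : m = 0 := Finsupp.ext fun v => h v trivial
  exact mem_support_iff.mp hm hp

/-- Koszul vanishing descends to the quotient by `I` from a ring in which it is localized at elements
with nonzero constant coefficient. -/
theorem koszulVanishes_of_ringHom {C' : Type*} [CommRing C'] (I : Ideal (MvPolynomial V k))
    (f : MvPolynomial V k →+* C') (hI : ∀ a ∈ I, f a = 0)
    (hker : ∀ a, f a = 0 → ∃ t, constantCoeff t ≠ 0 ∧ t * a ∈ I)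
    (hden : ∀ b : Finset V → C', ∃ s, constantCoeff s ≠ 0 ∧ ∀ F, ∃ a, f a = f s * b F) {i : ℕ}
    (h : ∀ c : Finset V → C',
      (∀ F : Finset V, F.card = i + 1 → koszulD (fun v => f (X v)) c F = 0) →
      ∃ b : Finset V → C', ∀ F : Finset V, F.card = i → koszulD (fun v => f (X v)) b F = c F) :
    KoszulVanishes I i := by
  intro c hc
  let N : Ideal (MvPolynomial V k) := RingHom.ker constantCoeff
  have hN : N.IsPrime := RingHom.ker_isPrime _
  obtain ⟨b, hb⟩ := h (fun G => f (c G)) fun F hF => by rw [koszulD_ringHom, hI _ (hc F hF)]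
  obtain ⟨s, hs, hsb⟩ := hden b
  choose b' hb' using hsb
  obtain ⟨t, ht, htI⟩ := exists_notMem_forall_mul_mem N I (s • c - koszulD (R := MvPolynomial V k) X b')
    (fun F : Finset V => F.card = i) fun F hF => by
      refine hker _ ?_
      have h2 : f (koszulD (R := MvPolynomial V k) X b' F) = f s * koszulD (fun v => f (X v)) b F := by
        rw [← koszulD_ringHom]
        have : (fun G => f (b' G)) = f s • b := funext hb'
        rw [this, map_smul]
        rfl
      rw [Pi.sub_apply, map_sub, h2, hb F hF, Pi.smul_apply, smul_eq_mul, map_mul, sub_self]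
  set u := t * s with hu
  have hu0 : constantCoeff u ≠ 0 := Ideal.IsPrime.mul_notMem hN ht hs
  -- The difference of `u` and its constant term lies in the ideal of the variables, which kills the
  -- cohomology. So `u` acts as a nonzero scalar and can be divided out.
  obtain ⟨e, he⟩ := exists_koszulD_eq_smul (X : V → MvPolynomial V k) I hc
    (mem_span_range_X (p := u - C (constantCoeff u)) (by simp))
  refine ⟨(C (constantCoeff u)⁻¹ : MvPolynomial V k) • (t • b' - e), fun F hF => ?_⟩
  have h1 := I.mul_mem_left (C (constantCoeff u)⁻¹) (I.sub_mem (htI F hF) (he F hF))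
  have h2 : (C (constantCoeff u)⁻¹ : MvPolynomial V k) * C (constantCoeff u) = 1 := by
    rw [← map_mul, inv_mul_cancel₀ hu0, map_one]
  rw [map_smul, map_sub, map_smul]
  simp only [Pi.sub_apply, Pi.smul_apply, smul_eq_mul] at h1 ⊢
  convert h1 using 1
  rw [hu] at h2 ⊢
  linear_combination (-c F) * h2

theorem koszulVanishes_of_isWeaklyRegular {I : Ideal (MvPolynomial V k)}
    (M : Ideal (MvPolynomial V k ⧸ I)) [M.IsPrime]
    (hM : ∀ a, Ideal.Quotient.mk I a ∈ M ↔ constantCoeff a = 0) (A : Type*) [CommRing A]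
    [Algebra (MvPolynomial V k ⧸ I) A] [IsLocalization.AtPrime A M] {rs : List A}
    (hreg : RingTheory.Sequence.IsWeaklyRegular A rs)
    (hrs : ∀ r ∈ rs, r ∈ M.map (algebraMap (MvPolynomial V k ⧸ I) A)) {i : ℕ}
    (hi : i < rs.length) : KoszulVanishes I i := by
  have hle : M.map (algebraMap (MvPolynomial V k ⧸ I) A) ≤ Ideal.span (Set.range fun v =>
      ((algebraMap _ A).comp (Ideal.Quotient.mk I)) (X v)) := by
    rw [Ideal.map_le_iff_le_comap]
    intro a ha
    obtain ⟨p, rfl⟩ := Ideal.Quotient.mk_surjective a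
    have := Ideal.mem_map_of_mem ((algebraMap _ A).comp (Ideal.Quotient.mk I))
      (mem_span_range_X ((hM p).mp ha))
    rw [Ideal.map_span, ← Set.range_comp] at this
    exact this
  refine koszulVanishes_of_ringHom I ((algebraMap _ A).comp (Ideal.Quotient.mk I))
    (fun a ha => ?_) (fun a ha => ?_) (fun b => ?_)
    (exists_koszulD_eq_of_isWeaklyRegular _ rs hreg (fun r hr => hle (hrs r hr)) i hi)
  · rw [RingHom.comp_apply, Ideal.Quotient.eq_zero_iff_mem.mpr ha, map_zero]
  · rw [RingHom.comp_apply, IsLocalization.map_eq_zero_iff M.primeCompl] at ha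
    obtain ⟨⟨w, hwM⟩, hw⟩ := ha
    obtain ⟨w, rfl⟩ := Ideal.Quotient.mk_surjective w
    refine ⟨w, fun h' => hwM ((hM w).mpr h'), ?_⟩
    rwa [← map_mul, Ideal.Quotient.eq_zero_iff_mem] at hw
  · obtain ⟨⟨s, hsM⟩, hs⟩ := IsLocalization.exist_integer_multiples_of_finite M.primeCompl b
    obtain ⟨s, rfl⟩ := Ideal.Quotient.mk_surjective s
    refine ⟨s, fun h' => hsM ((hM s).mpr h'), fun F => ?_⟩
    obtain ⟨a, ha⟩ := hs F
    obtain ⟨a, rfl⟩ := Ideal.Quotient.mk_surjective a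
    exact ⟨a, by rw [RingHom.comp_apply, ha, RingHom.comp_apply, Algebra.smul_def]⟩

theorem acyclicAt_lk_of_isCohenMacaulay (hΔ : IsLowerSet Δ) {D : Finset V} (hD : D ∈ Δ)
    (h : IsCohenMacaulay (MvPolynomial V k ⧸ faceIdeal k Δ)) (G : Finset V) (n : ℕ)
    (hn : n + G.card < D.card) : AcyclicAt k (lk Δ G) n := by
  have h0 : ∅ ∈ Δ := hΔ (Finset.empty_subset D) hD
  set M := RingHom.ker (augmentation k hΔ h0) with hM
  have hmax : M.IsMaximal :=
    RingHom.ker_isMaximal_of_surjective _ (augmentation_surjective hΔ h0)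
  have hdepth : ((D.card : ℕ∞) : WithBot ℕ∞) ≤ localDepth (Localization.AtPrime M) := by
    rw [h.depth_eq_dim M, IsLocalization.AtPrime.ringKrullDim_eq_height M (Localization.AtPrime M)]
    exact WithBot.coe_le_coe.mpr (card_le_height_ker_augmentation hΔ h0 hD)
  -- A strict inequality is needed to extract an actual sequence from the supremum; `hn` ensures
  -- that `D.card` is positive.
  have hdepth : ((D.card - 1 : ℕ) : ℕ∞) < localDepth (Localization.AtPrime M) := by
    refine lt_of_lt_of_le ?_ (WithBot.coe_le_coe.mp hdepth)
    exact_mod_cast (by omega : D.card - 1 < D.card)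
  obtain ⟨⟨rs, hreg, hmem⟩, hlt⟩ := lt_iSup_iff.mp hdepth
  have hlen : D.card ≤ rs.length := by
    have : D.card - 1 < rs.length := by exact_mod_cast hlt
    omega
  refine (acyclicAt_lk_iff_del hΔ D.card).mpr (fun H m hm => ?_) G n hn
  refine acyclicAt_of_koszulVanishes hΔ (koszulVanishes_of_isWeaklyRegular M
    (fun a => by rw [hM, RingHom.mem_ker, augmentation_mk]) (Localization.AtPrime M)
    hreg.toIsWeaklyRegular (fun r hr => ?_) (by omega))
  rw [Localization.AtPrime.map_eq_maximalIdeal]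
  exact hmem r hr

theorem isCohenMacaulay_iff_linksAcyclic (hΔ : IsLowerSet Δ) (h0 : ∅ ∈ Δ) :
    IsCohenMacaulay (MvPolynomial V k ⧸ faceIdeal k Δ) ↔ LinksAcyclic k Δ := by
  classical
  obtain ⟨D, hD, hmax⟩ := Finset.exists_max_image (Finset.univ.filter (· ∈ Δ)) Finset.card
    ⟨∅, by simpa using h0⟩
  have hD : D ∈ Δ := (Finset.mem_filter.mp hD).2
  have hmax : ∀ F ∈ Δ, F.card ≤ D.card := fun F hF => hmax F (by simpa using hF)
  constructor
  · intro h G hG F hF n hn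
    refine acyclicAt_lk_of_isCohenMacaulay hΔ hD h G n ?_
    have := hmax _ hF.2
    rw [Finset.card_union_of_disjoint hF.1] at this
    omega
  · exact fun h => isCohenMacaulay_of_acyclicAt hΔ hmax
      (h.acyclicAt_lk hΔ hmax ⟨D, hD, rfl⟩)

end CohenMacaulay

end Reisner

theorem mainTheorem1 {V : Type*} [Fintype V] [LinearOrder V] {k : Type*} [Field k]
    (S : AbstractSimplicialComplex V) :
    Reisner.IsCohenMacaulay (Reisner.FaceRing k S.toPreAbstractSimplicialComplex) ↔
      (∀ σ ∈ Reisner.faceSet S.toPreAbstractSimplicialComplex,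
        ∀ i : ℤ, i < Reisner.dim (Reisner.link S.toPreAbstractSimplicialComplex σ) →
          CategoryTheory.Limits.IsZero
            (Reisner.reducedHomology k (Reisner.link S.toPreAbstractSimplicialComplex σ) i)) ∧
      (∀ i : ℤ, i < Reisner.dim S.toPreAbstractSimplicialComplex →
        CategoryTheory.Limits.IsZero
          (Reisner.reducedHomology k S.toPreAbstractSimplicialComplex i)) := by
  set K := S.toPreAbstractSimplicialComplex
  have h0 : ∅ ∈ Reisner.faceSet K := Set.mem_insert _ _
  rw [Reisner.forall_isZero_link_iff, Reisner.forall_isZero_reducedHomology_iff]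
  -- The condition on the whole complex is the link condition at the empty face.
  refine (Reisner.isCohenMacaulay_iff_linksAcyclic (Reisner.isLowerSet_faceSet K) h0).trans
    (and_iff_left_of_imp fun h => ?_).symm
  have := h ∅ h0
  rwa [Reisner.lk_empty] at this
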